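/- **Setting.** Let $d\ge 1$, $A=\{0,\dots,d\}$, let $(e_i)_{0\le i\le d}$ be the canonical basis of $\mathbb R^{d+1}$, $h(y)=\sum_i y_i$, $P=\{y\in\mathbb R^{d+1}: h(y)=0\}$ with Lebesgue measure $\lambda$, $\Lambda=P\cap\mathbb Z^{d+1}$, and $q:P\to P/\Lambda$ the quotient map; $\lambda$ also denotes Lebesgue measure on $P/\Lambda$. Let $\Delta=\{v\in\mathbb R_+^{d+1}: h(v)=1\}$; a positive direction is represented by its unique vector in $\Delta$, and is totally irrational if its coordinates are linearly independent over $\mathbb Q$. For $v\in\Delta$ let $\pi_v(z)=z-h(z)v$ be the projection onto $P$ along $v$. For a finite word $w$, $\mathrm{ab}(w)\in\mathbb Z^{d+1}$ counts the occurrences of each letter. For an infinite word $w\in A^{\mathbb N}$ and $a\in A$ put $W(w)=\{\mathrm{ab}(p): p \text{ prefix of } w\}$ and $W_a(w)=\{\mathrm{ab}(p): pa\text{ prefix of }w\}$. Let $S$ be a finite set of non-erasing unimodular substitutions on $A$ (unimodular: the matrix $\mathrm{ab}(\sigma)$, whose $b$-th column is $\mathrm{ab}(\sigma(b))$, has determinant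 $\pm1$), and $s=(s_k)\in S^{\mathbb N}$; put $M_{[0,n)}=\mathrm{ab}(s_0)\cdots\mathrm{ab}(s_{n-1})$. A fixed point of $s$ is a sequence $u=(u_k)$ of infinite words with $s_k(u_{k+1})=u_k$ for all $k$. The subshift $\Omega_s$ is the set of $w\in A^{\mathbb N}$ all of whose factors are factors of words $s_0\circ\cdots\circ s_{n-1}(a)$, $n\in\mathbb N$, $a\in A$; it is equipped with the shift map. The sequence $s$ is *good with direction $v\in\Delta$* if (1) $\limsup_n \frac1n\ln\|\pi_vM_{[0,n)}\|_1<0$; (2) $v$ is totally irrational; (3) there are a fixed point $u$ of $s$, integers $k_0<k_1<\cdots$ and $r>0$ such that for all $n$ and all $a\in A$ there is $p\in P$ such that every $z\in\mathbb Z^{d+1}$ with $h(z)\ge0$ and $\|\pi_{v^{(k_n)}}(z)-p\|_1<r$ belongs to $W_a(u_{k_n})$, where $v^{(k)}\in\Delta$ is the positive multiple of $M_{[0,k)}^{-1}v$; (4) $v^{(k_n)}$ converges to a totally irrational direction. **Definitions (partitions and fundamental domains are understood up to Lebesgue-null sets).** For a translation $T_t:z\mapsto z+t$ of $P/\Lambda$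 and a finite measurable partition $(Q_i)_{i\in I}$ of $P/\Lambda$, the coding $\mathrm{cod}:P/\Lambda\to I^{\mathbb N}$ is defined almost everywhere by $T_t^n z\in Q_{\mathrm{cod}(z)_n}$ for all $n$. The partition is a *nice generating partition* for $T_t$ if: (generating) $\mathrm{cod}$ is injective on a set of full measure; (regular) for each $i$, $\overline{Q_i}$ is the closure of the interior of $Q_i$ and $\lambda(\partial Q_i)=0$; (liftable) there are a measurable fundamental domain $D\subseteq P$ for $\Lambda$, a measurable partition $(D_i)_{i\in I}$ of $D$ with $D_i\subseteq D$, and vectors $t_i\in P$ with $D_i+t_i\subseteq D$, $q(D_i)=Q_i$, $q(t_i)=t$; and each $Q_i$ is a bounded remainder set: there is $K$ such that for almost every $z$ and all $N\in\mathbb N$, $\left|\sum_{n<N}\mathbf 1_{Q_i}(T_t^nz)-N\lambda(Q_i)/\lambda(P/\Lambda)\right|\le K$. **Theorem.** Let $s\in S^{\mathbb N}$ be good with direction $v$. Then $v$ is the only direction with which $s$ is good; every fixed point $u$ of $s$ is such that $u_0$ has frequency vector $v$; and the Rauzy fractal $R(s)=\overline{\pi_vW(u_0)}$ and its pieces $R_a(s)=\overline{\pi_vW_a(u_0)}$,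 $a\in A$, do not depend on the fixed point $u$. Moreover: * $R(s)$ is a measurable fundamental domain of $P$ for the lattice $\Lambda$ (up to null sets). * $R(s)=\bigcup_{a\in A}R_a(s)$, with $\lambda(R_a(s)\cap R_b(s))=0$ for $a\ne b$, and each $R_a(s)$ is the closure of its interior. * $(q(R_a(s)))_{a\in A}$ is a nice generating partition for the translation $T$ of $P/\Lambda$ by $q(e_0-v)$. * The coding of $T$ for this partition is a measurable conjugacy with the subshift $\Omega_s$: there is a finite shift-invariant Borel measure $\nu$ carried by $\Omega_s$ such that, after removing null sets, the coding is a bimeasurable, measure-preserving bijection from $(P/\Lambda,\lambda)$ to $(\Omega_s,\nu)$ conjugating $T$ to the shift. -/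

import Mathlib

open MeasureTheory Filter Topology Set

namespace SAdic

noncomputable section

/-! ### Geometrical setting -/

/-- The ambient space `ℝ^{d+1}`, with coordinates indexed by `0, …, d`. -/
abbrev E (d : ℕ) : Type := EuclideanSpace ℝ (Fin (d + 1))

/-- The `1`-norm of a vector. -/
def norm1 {d : ℕ} (y : E d) : ℝ := ∑ i, |y i|

/-- The linear form `h`, sum of the coordinates. -/
def h (d : ℕ) : E d →ₗ[ℝ] ℝ where
  toFun y := ∑ i, y i
  map_add' y z := by simp [Finset.sum_add_distrib]
  map_smul' c y := by simp [Finset.mul_sum]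

/-- The hyperplane `P = {y | h y = 0}`; its Lebesgue measure `volume` is the one of the Euclidean
structure induced by `ℝ^{d+1}`. -/
abbrev P (d : ℕ) : Submodule ℝ (E d) := LinearMap.ker (h d)

/-- The lattice `Λ = P ∩ ℤ^{d+1}`. -/
def Lam (d : ℕ) : AddSubgroup (P d) where
  carrier := {p | ∀ i, ∃ m : ℤ, (p : E d) i = m}
  zero_mem' := fun _ => ⟨0, by simp⟩
  add_mem' := by
    intro a b ha hb i
    obtain ⟨m, hm⟩ := ha i
    obtain ⟨n, hn⟩ := hb i
    exact ⟨m + n, by simp [hm, hn]⟩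
  neg_mem' := by
    intro a ha i
    obtain ⟨m, hm⟩ := ha i
    exact ⟨-m, by simp [hm]⟩

/-- The torus `P / Λ`. -/
abbrev Torus (d : ℕ) : Type := P d ⧸ Lam d

/-- The quotient map `q : P → P / Λ`. -/
def q (d : ℕ) : P d → Torus d := fun p => (p : Torus d)

/-- The box `{p ∈ P | 0 ≤ p_i < 1 for i = 1, …, d}`, which contains exactly one point of each
coset of `Λ`. -/
def unitBox (d : ℕ) : Set (P d) := {p | ∀ i : Fin (d + 1), i ≠ 0 → (p : E d) i ∈ Ico (0 : ℝ) 1}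

/-- Lebesgue measure on the torus `P / Λ`, transported from `P`. -/
def torusMeasure (d : ℕ) : Measure (Torus d) :=
  Measure.map (q d) ((volume : Measure (P d)).restrict (unitBox d))

/-- The simplex `Δ` of non-negative vectors of `1`-norm `1`. A positive direction `x` is
represented by its unique representative `v(x)` in the simplex. -/
abbrev Simplex (d : ℕ) : Type := {v : E d // (∀ i, 0 ≤ v i) ∧ h d v = 1}

/-- `v` is the direction `[z]` of the vector `z`. -/
def IsDirectionOf {d : ℕ} (v : Simplex d) (z : E d) : Prop := ∃ c : ℝ, 0 < c ∧ z = c • (v : E d)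

/-- A direction is totally irrational when its coordinates are linearly independent over `ℚ`. -/
def TotallyIrrational {d : ℕ} (v : Simplex d) : Prop := LinearIndependent ℚ fun i => (v : E d) i

/-- The projection `π_v` onto `P` along `v`: `z ↦ z - h(z) v`. -/
def proj {d : ℕ} (v : Simplex d) : E d →ₗ[ℝ] P d :=
  LinearMap.codRestrict (P d) (LinearMap.id - (h d).smulRight (v : E d)) (by
    intro z
    simp [v.2.2])

/-- An integer vector seen in `ℝ^{d+1}`. -/
def toE {d : ℕ} (z : Fin (d + 1) → ℤ) : E d := WithLp.toLp 2 fun i => (z i : ℝ)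

/-- The vector `e_i` of the canonical basis. -/
def e {d : ℕ} (i : Fin (d + 1)) : E d := EuclideanSpace.single i 1

/-- The operator norm of a linear map for the `1`-norm. -/
def opNorm1 {d : ℕ} (f : E d →ₗ[ℝ] E d) : ℝ := ⨆ z : {z : E d // z ≠ 0}, norm1 (f z) / norm1 z.1

/-! ### Words and substitutions -/

/-- The word `w_k w_{k+1} ⋯ w_{k+n-1}`. -/
def factor {d : ℕ} (w : ℕ → Fin (d + 1)) (k n : ℕ) : List (Fin (d + 1)) :=
  (List.range n).map fun i => w (k + i)

/-- The shift map on infinite words. -/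
def shift {d : ℕ} (w : ℕ → Fin (d + 1)) : ℕ → Fin (d + 1) := fun n => w (n + 1)

/-- The abelianization of a finite word. -/
def ab {d : ℕ} (l : List (Fin (d + 1))) : Fin (d + 1) → ℤ := fun a => (l.count a : ℤ)

/-- A non-erasing substitution on the alphabet `{0, …, d}`, given by the images of the letters. -/
structure Substitution (d : ℕ) where
  img : Fin (d + 1) → List (Fin (d + 1))
  nonerasing : ∀ a, img a ≠ []

/-- The action of a substitution on finite words, by concatenation. -/
def Substitution.onWord {d : ℕ} (σ : Substitution d) (l : List (Fin (d + 1))) :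
    List (Fin (d + 1)) := l.flatMap σ.img

lemma Substitution.length_le_onWord {d : ℕ} (σ : Substitution d) (l : List (Fin (d + 1))) :
    l.length ≤ (σ.onWord l).length := by
  induction l with
  | nil => simp
  | cons a l ih =>
    have ha : 1 ≤ (σ.img a).length := List.length_pos_iff.mpr (σ.nonerasing a)
    simp only [Substitution.onWord, List.flatMap_cons, List.length_append, List.length_cons] at *
    omega

/-- The action of a non-erasing substitution on infinite words: the limit of the images of the
prefixes. Its letter of index `i` is the one of the image of the prefix of length `i + 1`, which
has length at least `i + 1`. -/
def Substitution.onInfinite {d : ℕ} (σ : Substitution d) (w : ℕ → Fin (d + 1)) :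
    ℕ → Fin (d + 1) := fun i =>
  (σ.onWord (factor w 0 (i + 1)))[i]'(by
    have := σ.length_le_onWord (factor w 0 (i + 1))
    simp only [factor, List.length_map, List.length_range] at this ⊢
    omega)

/-- The matrix of a substitution: the column of index `b` is the abelianization of `σ(b)`. -/
def Substitution.mat {d : ℕ} (σ : Substitution d) : Matrix (Fin (d + 1)) (Fin (d + 1)) ℤ :=
  Matrix.of fun a b => ab (σ.img b) a

/-- A substitution is unimodular if its matrix has determinant `1` or `-1`. -/
def Substitution.IsUnimodular {d : ℕ} (σ : Substitution d) : Prop := |σ.mat.det| = 1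

/-! ### Directive sequences -/

/-- `s_{[0,n)}(l) = s_0 ∘ ⋯ ∘ s_{n-1} (l)`. -/
def iterWord {d : ℕ} (s : ℕ → Substitution d) : ℕ → List (Fin (d + 1)) → List (Fin (d + 1))
  | 0, l => l
  | n + 1, l => iterWord s n ((s n).onWord l)

/-- The matrix `M_{[0,n)} = M_0 ⋯ M_{n-1}`. -/
def iterMat {d : ℕ} (s : ℕ → Substitution d) : ℕ → Matrix (Fin (d + 1)) (Fin (d + 1)) ℝ
  | 0 => 1
  | n + 1 => iterMat s n * (s n).mat.map (Int.cast : ℤ → ℝ)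

/-- The language of `s`: all the factors of the words `s_{[0,n)}(a)`. -/
def language {d : ℕ} (s : ℕ → Substitution d) : Set (List (Fin (d + 1))) :=
  {l | ∃ n a, l <:+: iterWord s n [a]}

/-- The `S`-adic subshift `Ω_s`: infinite words all of whose factors are in the language. -/
def subshift {d : ℕ} (s : ℕ → Substitution d) : Set (ℕ → Fin (d + 1)) :=
  {w | ∀ k n, factor w k n ∈ language s}

/-- A fixed point of a directive sequence: a sequence of infinite words with
`s_k(u_{k+1}) = u_k`. -/
def IsFixedPoint {d : ℕ} (s : ℕ → Substitution d) (u : ℕ → ℕ → Fin (d + 1)) : Prop :=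
  ∀ k, (s k).onInfinite (u (k + 1)) = u k

/-- `v` is the frequency vector of the infinite word `w`. -/
def HasFrequency {d : ℕ} (w : ℕ → Fin (d + 1)) (v : E d) : Prop :=
  Tendsto (fun n : ℕ => (1 / (n : ℝ)) • toE (ab (factor w 0 n))) atTop (𝓝 v)

/-! ### Worms and Rauzy fractals -/

/-- The worm `W(w)`: abelianizations of the prefixes. -/
def worm {d : ℕ} (w : ℕ → Fin (d + 1)) : Set (Fin (d + 1) → ℤ) :=
  {z | ∃ n, z = ab (factor w 0 n)}

/-- The piece `W_a(w)` of the worm: abelianizations of the prefixes followed by `a`. -/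
def wormPiece {d : ℕ} (w : ℕ → Fin (d + 1)) (a : Fin (d + 1)) : Set (Fin (d + 1) → ℤ) :=
  {z | ∃ n, w n = a ∧ z = ab (factor w 0 n)}

/-- The Rauzy fractal of a word `w` whose frequency vector is `v`: the closure of `π_v W(w)`. -/
def rauzy {d : ℕ} (v : Simplex d) (w : ℕ → Fin (d + 1)) : Set (P d) :=
  closure ((fun z => proj v (toE z)) '' worm w)

/-- The pieces of the Rauzy fractal: the closures of the sets `π_v W_a(w)`. -/
def rauzyPiece {d : ℕ} (v : Simplex d) (w : ℕ → Fin (d + 1)) (a : Fin (d + 1)) : Set (P d) :=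
  closure ((fun z => proj v (toE z)) '' wormPiece w a)

/-- The directive sequence `s` is good, with direction (represented by) `v`. -/
structure IsGoodWithDirection {d : ℕ} (s : ℕ → Substitution d) (v : Simplex d) : Prop where
  /-- `limsup (1/n) ln ‖π_v M_{[0,n)}‖₁ < 0`, as an extended real number. -/
  contraction :
    limsup (fun n : ℕ =>
      (((1 / (n : ℝ)) * Real.log (opNorm1
        ((P d).subtype ∘ₗ proj v ∘ₗ Matrix.toEuclideanLin (iterMat s n))) : ℝ) : EReal)) atTop < 0
  /-- The direction is totally irrational. -/
  irrational : TotallyIrrational v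
  /-- For some fixed point `u`, along some increasing sequence `k_n`, with `y n` the direction
  `M_{[0,k_n)}⁻¹ v`, all the pieces of the worm of `u_{k_n}` contain the integer points of the
  half-space that project to a ball of radius `r`, and `y` has a totally irrational limit. -/
  balls : ∃ (u : ℕ → ℕ → Fin (d + 1)) (k : ℕ → ℕ) (r : ℝ) (y : ℕ → Simplex d),
    IsFixedPoint s u ∧ StrictMono k ∧ 0 < r ∧
    (∀ n, IsDirectionOf (y n) (Matrix.toEuclideanLin (iterMat s (k n))⁻¹ (v : E d))) ∧
    (∀ n a, ∃ p : P d, ∀ z : Fin (d + 1) → ℤ, 0 ≤ ∑ i, z i →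
      norm1 ((proj (y n) (toE z) : E d) - (p : E d)) < r → z ∈ wormPiece (u (k n)) a) ∧
    ∃ l : Simplex d, TotallyIrrational l ∧ Tendsto y atTop (𝓝 l)

/-! ### Codings and partitions

Partitions, and the domains of which they are partitions, are understood up to sets of measure
zero. -/

/-- A measurable partition, up to sets of measure zero, of the set `D`. -/
structure IsMeasurablePartition {X I : Type*} [MeasurableSpace X] (μ : Measure X) (D : Set X)
    (Q : I → Set X) : Prop where
  measurableSet : ∀ i, MeasurableSet (Q i)
  aedisjoint : Pairwise fun i j => AEDisjoint μ (Q i) (Q j)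
  iUnion_eq : (⋃ i, Q i) =ᵐ[μ] D

/-- The symbolic coding of the map `T` for the partition `Q`: `T^n z ∈ Q (coding T Q z n)`.
(At points whose orbit meets several atoms, or none, at the same time, which form a null set
when `T` preserves the measure, an arbitrary choice is made.) -/
def coding {X I : Type*} [Nonempty I] (T : X → X) (Q : I → Set X) (z : X) : ℕ → I :=
  fun n => Classical.epsilon fun i => T^[n] z ∈ Q i

/-- A generating partition: a measurable partition whose coding is injective almost everywhere. -/
def IsGenerating {X I : Type*} [Nonempty I] [MeasurableSpace X] (μ : Measure X) (T : X → X)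
    (Q : I → Set X) : Prop :=
  IsMeasurablePartition μ univ Q ∧ ∃ X' : Set X, μ X'ᶜ = 0 ∧ InjOn (coding T Q) X'

/-- Regular partitions: the closure of each atom is the closure of its interior and the boundary
of each atom has measure zero. -/
def IsRegular {X I : Type*} [TopologicalSpace X] [MeasurableSpace X] (μ : Measure X)
    (Q : I → Set X) : Prop :=
  ∀ i, closure (Q i) = closure (interior (Q i)) ∧ μ (frontier (Q i)) = 0

/-- A bounded remainder set for the map `T`. -/
def IsBoundedRemainder {X : Type*} [MeasurableSpace X] (μ : Measure X) (T : X → X)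
    (B : Set X) : Prop :=
  MeasurableSet B ∧ ∃ K : ℝ, ∀ᵐ z ∂μ, ∀ N : ℕ,
    |∑ n ∈ Finset.range N, B.indicator (fun _ => (1 : ℝ)) (T^[n] z)
      - N * ((μ B).toReal / (μ univ).toReal)| ≤ K

/-- A family of subsets of the torus is liftable with respect to the translation by `t` if it
comes from a domain exchange on a measurable fundamental domain of `P` for the action of `Λ`. -/
def IsLiftable {d : ℕ} {I : Type*} (t : Torus d) (Q : I → Set (Torus d)) : Prop :=
  ∃ (D : Set (P d)) (D' : I → Set (P d)) (τ : I → P d),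
    MeasurableSet D ∧ IsAddFundamentalDomain (Lam d) D (volume : Measure (P d)) ∧
    IsMeasurablePartition (volume : Measure (P d)) D D' ∧
    ∀ i, D' i ⊆ D ∧ (∀ y ∈ D' i, y + τ i ∈ D) ∧ q d '' D' i = Q i ∧ q d (τ i) = t

/-- A nice generating partition with respect to the translation by `t` on the torus. -/
structure IsNiceGeneratingPartition {d : ℕ} {I : Type*} [Nonempty I] (t : Torus d)
    (Q : I → Set (Torus d)) : Prop where
  finite : Finite I
  generating : IsGenerating (torusMeasure d) (fun z => z + t) Q
  regular : IsRegular (torusMeasure d) Q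
  liftable : IsLiftable t Q
  boundedRemainder : ∀ i, IsBoundedRemainder (torusMeasure d) (fun z => z + t) (Q i)

/-- The map `φ` is a measurable conjugacy from `(X, T, μ)` to `(Y, U, ν)`: after removing null
sets it is a bimeasurable measure-preserving bijection that conjugates `T` to `U`. -/
def IsMeasurableConjugacy {X Y : Type*} [MeasurableSpace X] [MeasurableSpace Y]
    (μ : Measure X) (T : X → X) (ν : Measure Y) (U : Y → Y) (φ : X → Y) : Prop :=
  ∃ (X' : Set X) (Y' : Set Y),
    MeasurableSet X' ∧ MeasurableSet Y' ∧ μ X'ᶜ = 0 ∧ ν Y'ᶜ = 0 ∧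
    MapsTo T X' X' ∧ MapsTo U Y' Y' ∧ BijOn φ X' Y' ∧ (∀ z ∈ X', φ (T z) = U (φ z)) ∧
    (∀ B ⊆ Y', MeasurableSet B → MeasurableSet (X' ∩ φ ⁻¹' B) ∧ μ (X' ∩ φ ⁻¹' B) = ν B) ∧
    (∀ C ⊆ X', MeasurableSet C → MeasurableSet (φ '' C))

end

end SAdic

namespace SAdic

/-! ### Words and substitutions -/

variable {d : ℕ}

/-! Write `t = e_0 - v` and `T` for the translation by `q t`. Cutting a prefix of `u_n` along the
blocks `s_n(c)` expresses its projection as a term of size `O(ρ ^ n)` plus the projection of a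
prefix of `u_{n+1}`. Summing the geometric series puts all the pieces of level `n` in a ball of
radius `K * ρ ^ n` (`IsContracting.exists_pieceBound`). This yields the frequency vector, hence the
uniqueness of `v`. Moreover `R_a` is, for every `n`, a finite union of translates of these tiny
pieces. For infinitely many `n` all of them have an interior, so `R_a` is the closure of its
interior; as every letter occurs in `u_n`, `R_a` does not depend on the fixed point.

Modulo `Λ` the prefix of length `m` projects to `m t`. By Kronecker's theorem this orbit is dense,
so `R` covers the torus.

The heart is disjointness in measure (`ae_mem_simpleSet_zero`). The pieces of level `n` are the
bases of towers with floors `piece n b + j t`, `j < |s_{[0,n)}(b)|`, repeated along `Λ`. Let a point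
be simple if it lies in at most one such tile; towers of level `n + 1` refine those of level `n`, so
the simple sets decrease. When the worms contain balls, integrality shows that the image of the ball
in each floor is almost entirely simple (`volume_core_diff_simpleSet`). With `M y = c v`, the map
induced on `P` multiplies volumes by `1 / c`, while there are at least `c` floors: modulo `Λ` the
simple set is at least as large as a fixed ball, infinitely often. The intersection of the simple
sets therefore has positive measure. It is invariant up to a null set, because the bases and tops of
the towers have measure tending to `0`. Ergodicity makes it of full measure.

The rest follows from `IsPieceExchange`: `T` lifts almost everywhere to an exchange of the bounded
pieces `R_a`. Bounded remainder means bounded displacement of the lift. Two points with the same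
coding have lifted orbits differing by a constant `δ`, so that `R + δ ⊆ R`, and `δ = 0` since `R` is
bounded. The codings belong to `Ω_s` because their factors already occur in the word `u_0`, which
codes the orbit of `0`. -/

@[simp] lemma length_factor (w : ℕ → Fin (d + 1)) (k n : ℕ) : (factor w k n).length = n := by
  simp [factor]

@[simp] lemma getElem_factor (w : ℕ → Fin (d + 1)) (k n i : ℕ) (hi : i < (factor w k n).length) :
    (factor w k n)[i] = w (k + i) := by
  simp [factor]

@[simp] lemma factor_zero (w : ℕ → Fin (d + 1)) (k : ℕ) : factor w k 0 = [] := by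
  simp [factor]

lemma factor_add (w : ℕ → Fin (d + 1)) (k m n : ℕ) :
    factor w k (m + n) = factor w k m ++ factor w (k + m) n := by
  simp [factor, List.range_add, add_assoc]

lemma factor_succ (w : ℕ → Fin (d + 1)) (n : ℕ) :
    factor w 0 (n + 1) = factor w 0 n ++ [w n] := by
  simp [factor, List.range_succ]

lemma ab_append (l l' : List (Fin (d + 1))) : ab (l ++ l') = ab l + ab l' := by
  funext a; simp [ab]

@[simp] lemma ab_nil : ab ([] : List (Fin (d + 1))) = 0 := by
  funext a; simp [ab]

lemma ab_singleton (a : Fin (d + 1)) : ab [a] = Pi.single a 1 := by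
  funext b
  simp only [ab, List.count_singleton, Pi.single_apply]
  by_cases hab : a = b
  · simp [hab]
  · simp [hab, Ne.symm hab]

lemma ab_nonneg (l : List (Fin (d + 1))) (a : Fin (d + 1)) : 0 ≤ ab l a := by simp [ab]

lemma sum_ab (l : List (Fin (d + 1))) : ∑ a, ab l a = l.length := by
  induction l with
  | nil => simp
  | cons b l ih =>
    have : ab (b :: l) = ab [b] + ab l := ab_append [b] l
    rw [this]
    simp only [Pi.add_apply, Finset.sum_add_distrib, ih, ab_singleton]
    simp [add_comm]

/-! ### Block decomposition of the image of an infinite word -/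

namespace Substitution

variable (σ : Substitution d) (w : ℕ → Fin (d + 1))

@[simp] lemma onWord_nil : σ.onWord [] = [] := rfl

lemma onWord_append (l l' : List (Fin (d + 1))) :
    σ.onWord (l ++ l') = σ.onWord l ++ σ.onWord l' := by
  simp [onWord]

@[simp] lemma onWord_singleton (a : Fin (d + 1)) : σ.onWord [a] = σ.img a := by
  simp [onWord]

lemma ab_onWord (l : List (Fin (d + 1))) : ab (σ.onWord l) = σ.mat.mulVec (ab l) := by
  induction l with
  | nil => simp
  | cons b l ih =>
    have h1 : b :: l = [b] ++ l := rfl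
    rw [h1, onWord_append, ab_append, ab_append, Matrix.mulVec_add, ih, onWord_singleton,
      ab_singleton]
    congr 1
    funext a
    simp [mat]

/-- The position in `σ(w)` at which the image of the letter of index `i` of `w` starts. -/
def pos (i : ℕ) : ℕ := (σ.onWord (factor w 0 i)).length

@[simp] lemma pos_zero : σ.pos w 0 = 0 := by simp [pos]

lemma pos_succ (i : ℕ) : σ.pos w (i + 1) = σ.pos w i + (σ.img (w i)).length := by
  simp [pos, factor_succ, onWord_append]

lemma le_pos (i : ℕ) : i ≤ σ.pos w i := by
  have := σ.length_le_onWord (factor w 0 i)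
  simpa [pos] using this

lemma length_img_pos (a : Fin (d + 1)) : 0 < (σ.img a).length :=
  List.length_pos_iff.mpr (σ.nonerasing a)

lemma pos_mono : Monotone (σ.pos w) :=
  monotone_nat_of_le_succ fun i => by rw [pos_succ]; omega

lemma onWord_factor_prefix {i j : ℕ} (hij : i ≤ j) :
    σ.onWord (factor w 0 i) <+: σ.onWord (factor w 0 j) := by
  obtain ⟨k, rfl⟩ := Nat.exists_eq_add_of_le hij
  rw [factor_add, onWord_append]
  exact List.prefix_append _ _

lemma onInfinite_eq_getElem (i j : ℕ) (hj : j < (σ.onWord (factor w 0 i)).length) :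
    σ.onInfinite w j = (σ.onWord (factor w 0 i))[j] := by
  unfold onInfinite
  rcases le_total (j + 1) i with hij | hij
  · exact (σ.onWord_factor_prefix w hij).getElem _
  · exact ((σ.onWord_factor_prefix w hij).getElem _).symm

lemma factor_onInfinite (i : ℕ) :
    factor (σ.onInfinite w) 0 (σ.pos w i) = σ.onWord (factor w 0 i) := by
  apply List.ext_getElem
  · simp [pos]
  · intro j h1 h2
    rw [getElem_factor, Nat.zero_add, onInfinite_eq_getElem σ w i j h2]

lemma eq_onInfinite (x : ℕ → Fin (d + 1))
    (hx : ∀ i, factor x 0 (σ.pos w i) = σ.onWord (factor w 0 i)) : x = σ.onInfinite w := by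
  funext j
  have hj : j < σ.pos w (j + 1) := σ.le_pos w (j + 1)
  have h1 := hx (j + 1)
  rw [← factor_onInfinite] at h1
  have h2 := List.getElem_of_eq h1 (i := j) (by simpa using hj)
  simpa using h2

lemma factor_onInfinite_add (i j : ℕ) (hj : j ≤ (σ.img (w i)).length) :
    factor (σ.onInfinite w) 0 (σ.pos w i + j) =
      σ.onWord (factor w 0 i) ++ (σ.img (w i)).take j := by
  have h1 := σ.factor_onInfinite w (i + 1)
  rw [factor_succ, onWord_append, onWord_singleton, pos_succ] at h1
  have h2 : factor (σ.onInfinite w) 0 (σ.pos w i + j) =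
      (factor (σ.onInfinite w) 0 (σ.pos w i + (σ.img (w i)).length)).take (σ.pos w i + j) := by
    obtain ⟨k, hk⟩ := Nat.exists_eq_add_of_le hj
    rw [hk, ← add_assoc, factor_add _ _ (σ.pos w i + j) k, List.take_left' (by simp)]
  rw [h2, h1]
  simp [pos, List.take_append]

lemma onInfinite_pos_add (i j : ℕ) (hj : j < (σ.img (w i)).length) :
    σ.onInfinite w (σ.pos w i + j) = (σ.img (w i))[j] := by
  rw [onInfinite_eq_getElem σ w (i + 1) _ (by rw [← pos, pos_succ]; omega)]
  simp only [factor_succ, onWord_append, onWord_singleton]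
  rw [List.getElem_append_right (by simp [pos])]
  simp [pos]

lemma exists_pos_add (m : ℕ) :
    ∃ i j, i ≤ m ∧ j < (σ.img (w i)).length ∧ m = σ.pos w i + j := by
  induction m with
  | zero => exact ⟨0, 0, le_rfl, σ.length_img_pos _, by simp⟩
  | succ m ih =>
    obtain ⟨i, j, hi, hj, hm⟩ := ih
    by_cases hj' : j + 1 < (σ.img (w i)).length
    · exact ⟨i, j + 1, by omega, hj', by omega⟩
    · exact ⟨i + 1, 0, by omega, σ.length_img_pos _, by rw [pos_succ]; omega⟩

/-- Blocks do not overlap, so a position of `σ(w)` determines its block and its offset. This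
uniqueness is the combinatorial source of the disjointness of tiles. -/
lemma pos_add_inj {i j i' j' : ℕ} (hj : j < (σ.img (w i)).length)
    (hj' : j' < (σ.img (w i')).length) (heq : σ.pos w i + j = σ.pos w i' + j') :
    i = i' ∧ j = j' := by
  have key : i = i' := by
    rcases lt_trichotomy i i' with hlt | h | hlt
    · have := σ.pos_mono w (Nat.succ_le_of_lt hlt)
      rw [Nat.succ_eq_add_one, pos_succ] at this
      omega
    · exact h
    · have := σ.pos_mono w (Nat.succ_le_of_lt hlt)
      rw [Nat.succ_eq_add_one, pos_succ] at this
      omega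
  subst key
  exact ⟨rfl, by omega⟩

lemma ab_factor_onInfinite_add (i j : ℕ) (hj : j ≤ (σ.img (w i)).length) :
    ab (factor (σ.onInfinite w) 0 (σ.pos w i + j)) =
      σ.mat.mulVec (ab (factor w 0 i)) + ab ((σ.img (w i)).take j) := by
  rw [factor_onInfinite_add _ _ _ _ hj, ab_append, ab_onWord]

/-- A prefix of `σ(w)` followed by `a` ends inside the image of some letter `b` of `w`: it is the
image of the prefix of `w` before `b`, followed by a proper prefix of `σ(b)`. -/
lemma mem_wormPiece_onInfinite (a : Fin (d + 1)) (z : Fin (d + 1) → ℤ) :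
    z ∈ wormPiece (σ.onInfinite w) a ↔ ∃ b, ∃ y ∈ wormPiece w b,
      ∃ (j : ℕ) (hj : j < (σ.img b).length), (σ.img b)[j] = a ∧
        z = σ.mat.mulVec y + ab ((σ.img b).take j) := by
  constructor
  · rintro ⟨m, hm, rfl⟩
    obtain ⟨i, j, -, hj, rfl⟩ := σ.exists_pos_add w m
    refine ⟨w i, _, ⟨i, rfl, rfl⟩, j, hj, ?_, σ.ab_factor_onInfinite_add w i j hj.le⟩
    rw [← hm, onInfinite_pos_add]
  · rintro ⟨b, y, ⟨i, rfl, rfl⟩, j, hj, rfl, rfl⟩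
    exact ⟨σ.pos w i + j, σ.onInfinite_pos_add w i j hj,
      (σ.ab_factor_onInfinite_add w i j hj.le).symm⟩

end Substitution

/-! ### Iterated substitutions -/

variable (s : ℕ → Substitution d)

lemma iterWord_append (n : ℕ) (l l' : List (Fin (d + 1))) :
    iterWord s n (l ++ l') = iterWord s n l ++ iterWord s n l' := by
  induction n generalizing l l' with
  | zero => rfl
  | succ n ih => simp [iterWord, Substitution.onWord_append, ih]

@[simp] lemma iterWord_nil (n : ℕ) : iterWord s n [] = [] := by
  induction n with
  | zero => rfl
  | succ n ih => simp [iterWord, ih]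

lemma length_le_iterWord (n : ℕ) (l : List (Fin (d + 1))) :
    l.length ≤ (iterWord s n l).length := by
  induction n generalizing l with
  | zero => rfl
  | succ n ih => exact ((s n).length_le_onWord l).trans (ih _)

/-- The substitution `s_0 ∘ ⋯ ∘ s_{n-1}`. -/
def comp (n : ℕ) : Substitution d where
  img a := iterWord s n [a]
  nonerasing a := by
    have := length_le_iterWord s n [a]
    exact List.length_pos_iff.mp (lt_of_lt_of_le (by simp) this)

lemma comp_onWord (n : ℕ) (l : List (Fin (d + 1))) : (comp s n).onWord l = iterWord s n l := by
  induction l with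
  | nil => simp
  | cons b l ih =>
    have h1 : b :: l = [b] ++ l := rfl
    rw [h1, Substitution.onWord_append, iterWord_append, ih, Substitution.onWord_singleton]
    rfl

lemma comp_succ_img (n : ℕ) (a : Fin (d + 1)) :
    (comp s (n + 1)).img a = (comp s n).onWord ((s n).img a) := by
  rw [comp_onWord]
  simp [comp, iterWord]

lemma comp_succ_onWord (n : ℕ) (l : List (Fin (d + 1))) :
    (comp s (n + 1)).onWord l = (comp s n).onWord ((s n).onWord l) := by
  rw [comp_onWord, comp_onWord, iterWord]

lemma comp_zero_img (a : Fin (d + 1)) : (comp s 0).img a = [a] := rfl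

lemma IsFixedPoint.onInfinite_comp {s : ℕ → Substitution d} {u : ℕ → ℕ → Fin (d + 1)}
    (hu : IsFixedPoint s u) (n : ℕ) : (comp s n).onInfinite (u n) = u 0 := by
  symm
  induction n with
  | zero =>
    apply Substitution.eq_onInfinite
    intro i
    simp [Substitution.pos, comp_onWord, iterWord]
  | succ n ih =>
    apply Substitution.eq_onInfinite
    intro i
    have h1 := (s n).factor_onInfinite (u (n + 1)) i
    rw [hu n] at h1
    have h2 := (comp s n).factor_onInfinite (u n) ((s n).pos (u (n + 1)) i)
    rw [← ih, Substitution.pos, h1] at h2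
    rw [Substitution.pos, comp_succ_onWord, h2]

lemma comp_zero_mat : (comp s 0).mat = 1 := by
  ext a b
  simp only [Substitution.mat, comp_zero_img, Matrix.of_apply, ab_singleton, Matrix.one_apply,
    Pi.single_apply]

lemma comp_succ_mat (n : ℕ) : (comp s (n + 1)).mat = (comp s n).mat * (s n).mat := by
  ext a b
  have h1 : (comp s (n + 1)).mat a b = ab ((comp s (n + 1)).img b) a := rfl
  rw [h1, comp_succ_img, Substitution.ab_onWord]
  rfl

lemma iterMat_eq (n : ℕ) : iterMat s n = (comp s n).mat.map (Int.cast : ℤ → ℝ) := by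
  induction n with
  | zero => simp [iterMat, comp_zero_mat, Matrix.map_one]
  | succ n ih =>
    rw [iterMat, ih, comp_succ_mat]
    exact (Matrix.map_mul (f := Int.castRingHom ℝ)).symm

lemma abs_det_comp (hs : ∀ k, (s k).IsUnimodular) (n : ℕ) : |(comp s n).mat.det| = 1 := by
  induction n with
  | zero => simp [comp_zero_mat]
  | succ n ih => rw [comp_succ_mat, Matrix.det_mul, abs_mul, ih, hs n, one_mul]

end SAdic

namespace SAdic

noncomputable section

variable {d : ℕ}

/-! ### Norms and integer vectors -/

lemma h_apply (y : E d) : h d y = ∑ i, y i := rfl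

@[simp] lemma toE_apply (z : Fin (d + 1) → ℤ) (i : Fin (d + 1)) : (toE z : E d) i = z i := rfl

lemma toE_add (z w : Fin (d + 1) → ℤ) : (toE (z + w) : E d) = toE z + toE w := by
  ext i; simp

lemma toE_sub (z w : Fin (d + 1) → ℤ) : (toE (z - w) : E d) = toE z - toE w := by
  ext i; simp

@[simp] lemma toE_zero : (toE (0 : Fin (d + 1) → ℤ) : E d) = 0 := by
  ext i; simp

lemma h_toE (z : Fin (d + 1) → ℤ) : h d (toE z) = ((∑ i, z i : ℤ) : ℝ) := by
  simp [h_apply]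

lemma h_toE_ab (l : List (Fin (d + 1))) : h d (toE (ab l)) = l.length := by
  rw [h_toE, sum_ab]; simp

lemma norm1_toE_ab (l : List (Fin (d + 1))) : norm1 (toE (ab l) : E d) = l.length := by
  rw [← h_toE_ab, h_apply, norm1]
  refine Finset.sum_congr rfl fun i _ => abs_of_nonneg ?_
  rw [toE_apply]
  exact_mod_cast ab_nonneg l i

lemma norm1_nonneg (y : E d) : 0 ≤ norm1 y := Finset.sum_nonneg fun _ _ => abs_nonneg _

lemma norm_le_norm1 (y : E d) : ‖y‖ ≤ norm1 y := by
  rw [EuclideanSpace.norm_eq]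
  refine Real.sqrt_le_iff.mpr ⟨norm1_nonneg y, ?_⟩
  simp only [Real.norm_eq_abs, norm1]
  exact Finset.sum_sq_le_sq_sum_of_nonneg fun _ _ => abs_nonneg _

lemma norm1_le (y : E d) : norm1 y ≤ (d + 1) * ‖y‖ := by
  calc norm1 y ≤ ∑ _i : Fin (d + 1), ‖y‖ :=
        Finset.sum_le_sum fun i _ => by simpa using PiLp.norm_apply_le y i
    _ = (d + 1) * ‖y‖ := by simp

lemma continuous_norm1 : Continuous (norm1 : E d → ℝ) := by
  unfold norm1
  fun_prop

lemma norm1_eq_zero {y : E d} (hy : norm1 y = 0) : y = 0 :=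
  norm_le_zero_iff.mp (hy ▸ norm_le_norm1 y)

lemma norm1_le_opNorm1 (f : E d →ₗ[ℝ] E d) (z : E d) : norm1 (f z) ≤ opNorm1 f * norm1 z := by
  by_cases hz : z = 0
  · simp [hz, norm1]
  have hpos : ∀ z : E d, z ≠ 0 → 0 < norm1 z := fun z hz =>
    lt_of_le_of_ne (norm1_nonneg z) fun h0 => hz (norm1_eq_zero h0.symm)
  rw [← div_le_iff₀ (hpos z hz)]
  -- A real supremum of an unbounded family is `0` by convention, so boundedness is needed before
  -- `opNorm1` bounds anything.
  have hb : BddAbove (range fun z : {z : E d // z ≠ 0} => norm1 (f z) / norm1 z.1) := by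
    refine ⟨(d + 1) * ‖f.toContinuousLinearMap‖, ?_⟩
    rintro _ ⟨z, rfl⟩
    rw [div_le_iff₀ (hpos z.1 z.2)]
    calc norm1 (f z) ≤ (d + 1) * ‖f z‖ := norm1_le _
      _ ≤ (d + 1) * (‖f.toContinuousLinearMap‖ * ‖z.1‖) := by
          gcongr
          exact f.toContinuousLinearMap.le_opNorm z
      _ ≤ (d + 1) * ‖f.toContinuousLinearMap‖ * norm1 z.1 := by
          rw [mul_assoc]
          gcongr
          exact norm_le_norm1 _
  exact le_ciSup hb ⟨z, hz⟩

lemma coe_proj (v : Simplex d) (z : E d) : (proj v z : E d) = z - h d z • (v : E d) := rfl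

lemma proj_self (v : Simplex d) : proj v (v : E d) = 0 := by
  ext1; rw [coe_proj, v.2.2]; simp

lemma proj_eq_self (v : Simplex d) (x : P d) : proj v (x : E d) = x := by
  ext1; rw [coe_proj, LinearMap.mem_ker.mp x.2]; simp

lemma proj_eq_zero_iff {v : Simplex d} {z : E d} : proj v z = 0 ↔ z = h d z • (v : E d) := by
  rw [← sub_eq_zero (a := z), ← coe_proj, Submodule.coe_eq_zero]

/-! ### The projections of the matrices of a directive sequence -/

variable (s : ℕ → Substitution d) (v : Simplex d)

/-- The linear map `π_v M_{[0,n)}`. -/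
def projMat (n : ℕ) : E d →ₗ[ℝ] P d := proj v ∘ₗ Matrix.toEuclideanLin (iterMat s n)

lemma toEuclideanLin_iterMat_toE (n : ℕ) (z : Fin (d + 1) → ℤ) :
    Matrix.toEuclideanLin (iterMat s n) (toE z) = toE ((comp s n).mat.mulVec z) := by
  ext i
  rw [iterMat_eq]
  simp [Matrix.toLpLin_apply, Matrix.mulVec, dotProduct, toE]

lemma projMat_toE (n : ℕ) (z : Fin (d + 1) → ℤ) :
    projMat s v n (toE z) = proj v (toE ((comp s n).mat.mulVec z)) := by
  rw [projMat, LinearMap.comp_apply, toEuclideanLin_iterMat_toE]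

lemma projMat_zero : projMat s v 0 = proj v := by
  ext1 z
  simp [projMat, iterMat, Matrix.toLpLin_one]

lemma projMat_succ_toE (n : ℕ) (z : Fin (d + 1) → ℤ) :
    projMat s v (n + 1) (toE z) = projMat s v n (toE ((s n).mat.mulVec z)) := by
  rw [projMat_toE, projMat_toE, comp_succ_mat, Matrix.mulVec_mulVec]

/-- The maps `π_v M_{[0,n)}` decay exponentially. -/
def IsContracting : Prop :=
  ∃ C ρ : ℝ, 0 < C ∧ 0 < ρ ∧ ρ < 1 ∧ ∀ n z, ‖projMat s v n z‖ ≤ C * ρ ^ n * norm1 z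

variable {s v}

/-- Any real `c` strictly between the limsup and `0` gives the ratio `exp c` for large `n`; the
finitely many remaining norms are absorbed into the constant. -/
lemma IsGoodWithDirection.isContracting (hv : IsGoodWithDirection s v) : IsContracting s v := by
  set N : ℕ → ℝ := fun n => opNorm1
    ((P d).subtype ∘ₗ proj v ∘ₗ Matrix.toEuclideanLin (iterMat s n)) with hN
  have hle : ∀ n z, ‖projMat s v n z‖ ≤ N n * norm1 z := fun n z =>
    (norm_le_norm1 _).trans (norm1_le_opNorm1
      ((P d).subtype ∘ₗ proj v ∘ₗ Matrix.toEuclideanLin (iterMat s n)) z)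
  obtain ⟨c, hc1, hc2⟩ := EReal.lt_iff_exists_real_btwn.mp hv.contraction
  have hc0 : c < 0 := by exact_mod_cast hc2
  obtain ⟨n₀, hn₀⟩ := eventually_atTop.mp (eventually_lt_of_limsup_lt hc1)
  have hev : ∀ n, n₀ ≤ n → 1 ≤ n → N n ≤ Real.exp c ^ n := by
    intro n hn hn1
    have h1 : 1 / (n : ℝ) * Real.log (N n) < c := by exact_mod_cast hn₀ n hn
    have hnpos : (0 : ℝ) < n := by exact_mod_cast hn1
    -- The bound on `Real.log (N n)` is informative only for positive `N n`; otherwise the claim is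
    -- trivial.
    rcases le_or_gt (N n) 0 with h0 | h0
    · exact h0.trans (by positivity)
    · rw [one_div, inv_mul_lt_iff₀ hnpos, Real.log_lt_iff_lt_exp h0] at h1
      rw [← Real.exp_nat_mul]
      exact h1.le
  set n₁ := n₀ + 1
  set C := 1 + ∑ i ∈ Finset.range n₁, |N i| * (Real.exp c ^ i)⁻¹ with hC
  have hsum : ∀ i ∈ Finset.range n₁, 0 ≤ |N i| * (Real.exp c ^ i)⁻¹ := fun i _ => by positivity
  refine ⟨C, Real.exp c, ?_, Real.exp_pos c, by simpa using hc0, fun n z => ?_⟩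
  · have := Finset.sum_nonneg hsum
    linarith
  · refine (hle n z).trans (mul_le_mul_of_nonneg_right ?_ (norm1_nonneg z))
    have he : 0 < Real.exp c ^ n := by positivity
    by_cases hn : n < n₁
    · have h1 := Finset.single_le_sum hsum (Finset.mem_range.mpr hn)
      have h2 : |N n| * (Real.exp c ^ n)⁻¹ ≤ C := by linarith
      rw [← div_eq_mul_inv, div_le_iff₀ he] at h2
      exact (le_abs_self _).trans h2
    · refine (hev n (by omega) (by omega)).trans ?_
      have := Finset.sum_nonneg hsum
      nlinarith

/-- The images of the letters have bounded length. -/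
lemma exists_length_img_le {S : Set (Substitution d)} (hS : S.Finite) (hs : ∀ k, s k ∈ S) :
    ∃ B : ℕ, ∀ k a, ((s k).img a).length ≤ B := by
  obtain ⟨B, hB⟩ := (hS.image fun σ => ∑ a, (σ.img a).length).bddAbove
  refine ⟨B, fun k a => le_trans ?_ (hB ⟨s k, hs k, rfl⟩)⟩
  exact Finset.single_le_sum (f := fun a => ((s k).img a).length) (fun _ _ => Nat.zero_le _)
    (Finset.mem_univ a)

/-- The projected worms are bounded, with an exponentially decaying bound. -/
lemma IsContracting.exists_norm_projMat_factor_le (hc : IsContracting s v)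
    (hB : ∃ B : ℕ, ∀ k a, ((s k).img a).length ≤ B) :
    ∃ K ρ : ℝ, 0 < K ∧ 0 < ρ ∧ ρ < 1 ∧ ∀ u : ℕ → ℕ → Fin (d + 1), IsFixedPoint s u →
      ∀ n m, ‖projMat s v n (toE (ab (factor (u n) 0 m)))‖ ≤ K * ρ ^ n := by
  obtain ⟨C, ρ, hC, hρ, hρ1, hCρ⟩ := hc
  obtain ⟨B, hB⟩ := hB
  refine ⟨C * B * (1 - ρ)⁻¹ + 1, ρ, ?_, hρ, hρ1, fun u hu n m => ?_⟩
  · have : 0 < 1 - ρ := by linarith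
    positivity
  -- Induction on the number `N` of successive desubstitutions. Each one costs a proper prefix of an
  -- image, of length at most `B`; what remains is a prefix of `u (n + N)`, still of length at most
  -- `m`. With `m` fixed, its contribution vanishes as `N → ∞`.
  have key : ∀ N n m, ‖projMat s v n (toE (ab (factor (u n) 0 m)))‖ ≤
      C * B * ρ ^ n * (∑ i ∈ Finset.range N, ρ ^ i) + C * ρ ^ (n + N) * m := by
    intro N
    induction N with
    | zero =>
      intro n m
      refine (hCρ n _).trans ?_
      rw [norm1_toE_ab]
      simp
    | succ N ih =>
      intro n m
      obtain ⟨i, j, him, hj, hm⟩ := (s n).exists_pos_add (u (n + 1)) m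
      have h1 := (s n).ab_factor_onInfinite_add (u (n + 1)) i j hj.le
      rw [hu n, ← hm] at h1
      rw [h1, toE_add, map_add, ← projMat_succ_toE]
      have h2 := ih (n + 1) i
      have h3 : ‖projMat s v n (toE (ab (((s n).img (u (n + 1) i)).take j)))‖ ≤ C * ρ ^ n * B := by
        refine (hCρ n _).trans ?_
        rw [norm1_toE_ab]
        gcongr
        exact (List.length_take_le _ _).trans (hj.le.trans (hB n (u (n + 1) i)))
      refine (norm_add_le _ _).trans ((add_le_add h2 h3).trans ?_)
      have h4 : C * ρ ^ (n + 1 + N) * (i : ℝ) ≤ C * ρ ^ (n + 1 + N) * m := by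
        gcongr
      have h5 : ∑ i ∈ Finset.range (N + 1), ρ ^ i = (∑ i ∈ Finset.range N, ρ ^ i) * ρ + 1 := by
        rw [Finset.sum_range_succ', Finset.sum_mul]
        simp [pow_succ]
      have h6 : n + (N + 1) = n + 1 + N := by ring
      rw [h5, h6]
      have h7 : C * B * ρ ^ (n + 1) * (∑ i ∈ Finset.range N, ρ ^ i) + C * ρ ^ n * B =
          C * B * ρ ^ n * ((∑ i ∈ Finset.range N, ρ ^ i) * ρ + 1) := by ring
      linarith
  have hlim : Tendsto (fun N : ℕ => C * B * ρ ^ n * (∑ i ∈ Finset.range N, ρ ^ i) +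
      C * ρ ^ (n + N) * m) atTop (𝓝 (C * B * ρ ^ n * (1 - ρ)⁻¹ + C * 0 * m)) := by
    refine ((hasSum_geometric_of_lt_one hρ.le hρ1).tendsto_sum_nat.const_mul _).add ?_
    refine Tendsto.mul_const _ (Tendsto.const_mul _ ?_)
    simp_rw [pow_add]
    simpa using (tendsto_pow_atTop_nhds_zero_of_lt_one hρ.le hρ1).const_mul (ρ ^ n)
  have h1 := ge_of_tendsto' hlim fun N => key N n m
  have h2 : 0 < ρ ^ n := by positivity
  calc _ ≤ _ := h1
    _ ≤ _ := by ring_nf; linarith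

/-! ### Frequencies -/

/-- The prefix of length `m` has abelianization within `K` of `m v`; divide by `m`. Since the
frequency vector belongs to the word alone, this also forces the uniqueness of the good direction.
-/
lemma IsContracting.hasFrequency (hc : IsContracting s v)
    (hB : ∃ B : ℕ, ∀ k a, ((s k).img a).length ≤ B) {u : ℕ → ℕ → Fin (d + 1)}
    (hu : IsFixedPoint s u) : HasFrequency (u 0) (v : E d) := by
  obtain ⟨K, ρ, -, -, -, hK⟩ := hc.exists_norm_projMat_factor_le hB
  rw [HasFrequency, tendsto_iff_norm_sub_tendsto_zero]
  refine squeeze_zero' (Eventually.of_forall fun _ => norm_nonneg _) ?_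
    (tendsto_const_div_atTop_nhds_zero_nat K)
  filter_upwards [eventually_gt_atTop 0] with m hm
  have hm0 : (0 : ℝ) < m := by exact_mod_cast hm
  have h1 := hK u hu 0 m
  rw [projMat_zero, pow_zero, mul_one, Submodule.coe_norm, coe_proj, h_toE_ab,
    length_factor] at h1
  have h2 : (1 / (m : ℝ)) • (toE (ab (factor (u 0) 0 m)) : E d) - v =
      (1 / (m : ℝ)) • (toE (ab (factor (u 0) 0 m)) - (m : ℝ) • (v : E d)) := by
    rw [smul_sub, smul_smul, one_div_mul_cancel hm0.ne', one_smul]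
  rw [h2, norm_smul, Real.norm_of_nonneg (by positivity), one_div, inv_mul_eq_div]
  gcongr

lemma HasFrequency.unique {w : ℕ → Fin (d + 1)} {x y : E d} (hx : HasFrequency w x)
    (hy : HasFrequency w y) : x = y := tendsto_nhds_unique hx hy

/-! ### Pieces of the Rauzy fractals at all levels -/

variable (s v) in
/-- The closure of `π_v M_{[0,n)} W_b(u_n)`. -/
def piece (u : ℕ → ℕ → Fin (d + 1)) (n : ℕ) (b : Fin (d + 1)) : Set (P d) :=
  closure ((fun z => projMat s v n (toE z)) '' wormPiece (u n) b)

lemma rauzyPiece_eq_piece (u : ℕ → ℕ → Fin (d + 1)) (a : Fin (d + 1)) :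
    rauzyPiece v (u 0) a = piece s v u 0 a := by
  rw [rauzyPiece, piece, projMat_zero]

lemma worm_eq_iUnion (w : ℕ → Fin (d + 1)) : worm w = ⋃ a, wormPiece w a := by
  ext z
  simp [worm, wormPiece]

lemma rauzy_eq_iUnion (w : ℕ → Fin (d + 1)) : rauzy v w = ⋃ a, rauzyPiece v w a := by
  simp only [rauzy, rauzyPiece]
  rw [worm_eq_iUnion, image_iUnion, closure_iUnion_of_finite]

lemma isClosed_piece (u : ℕ → ℕ → Fin (d + 1)) (n : ℕ) (b : Fin (d + 1)) :
    IsClosed (piece s v u n b) := isClosed_closure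

/-- Closure commutes with finite unions and with translations, so the decomposition of worms passes
to closures. The map `f` is left free in order to serve for one step from level `n` to `n + 1` and
for `n` steps from level `0`. -/
lemma mem_closure_image_wormPiece_onInfinite (f : E d →ₗ[ℝ] P d) (σ : Substitution d)
    (w : ℕ → Fin (d + 1)) (a : Fin (d + 1)) (x : P d) :
    x ∈ closure ((fun z => f (toE z)) '' wormPiece (σ.onInfinite w) a) ↔
      ∃ b, ∃ j : Fin (σ.img b).length, (σ.img b)[j] = a ∧
        x - f (toE (ab ((σ.img b).take j))) ∈
          closure ((fun z => f (toE (σ.mat.mulVec z))) '' wormPiece w b) := by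
  have h1 : (fun z => f (toE z)) '' wormPiece (σ.onInfinite w) a =
      ⋃ p : {p : Σ b, Fin (σ.img b).length // (σ.img p.1)[p.2] = a},
        (Homeomorph.addRight (f (toE (ab ((σ.img p.1.1).take p.1.2))))) ''
          ((fun z => f (toE (σ.mat.mulVec z))) '' wormPiece w p.1.1) := by
    ext y
    simp only [mem_image, mem_iUnion, Homeomorph.coe_addRight]
    constructor
    · rintro ⟨z, hz, rfl⟩
      obtain ⟨b, y, hy, j, hj, hja, rfl⟩ := (σ.mem_wormPiece_onInfinite w a z).mp hz
      exact ⟨⟨⟨b, ⟨j, hj⟩⟩, hja⟩, _, ⟨y, hy, rfl⟩, by rw [toE_add, map_add]⟩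
    · rintro ⟨⟨⟨b, j⟩, hja⟩, _, ⟨y, hy, rfl⟩, rfl⟩
      exact ⟨_, (σ.mem_wormPiece_onInfinite w a _).mpr ⟨b, y, hy, j, j.2, hja, rfl⟩,
        by rw [toE_add, map_add]⟩
  rw [h1, closure_iUnion_of_finite]
  simp only [← Homeomorph.image_closure, mem_iUnion]
  constructor
  · rintro ⟨⟨⟨b, j⟩, hja⟩, y, hy, rfl⟩
    exact ⟨b, j, hja, by simpa using hy⟩
  · rintro ⟨b, j, hja, hx⟩
    exact ⟨⟨⟨b, j⟩, hja⟩, _, hx, by simp⟩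

variable {u : ℕ → ℕ → Fin (d + 1)}

lemma IsFixedPoint.mem_piece_succ (hu : IsFixedPoint s u) (n : ℕ) (b : Fin (d + 1)) (x : P d) :
    x ∈ piece s v u n b ↔ ∃ c, ∃ i : Fin ((s n).img c).length, ((s n).img c)[i] = b ∧
      x - projMat s v n (toE (ab (((s n).img c).take i))) ∈ piece s v u (n + 1) c := by
  have h1 := mem_closure_image_wormPiece_onInfinite (projMat s v n) (s n) (u (n + 1)) b x
  rw [hu n] at h1
  simp only [piece, projMat_succ_toE]
  exact h1

lemma IsFixedPoint.mem_piece_zero (hu : IsFixedPoint s u) (n : ℕ) (a : Fin (d + 1)) (x : P d) :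
    x ∈ piece s v u 0 a ↔ ∃ b, ∃ j : Fin ((comp s n).img b).length, ((comp s n).img b)[j] = a ∧
      x - proj v (toE (ab (((comp s n).img b).take j))) ∈ piece s v u n b := by
  have h1 := mem_closure_image_wormPiece_onInfinite (proj v) (comp s n) (u n) a x
  rw [hu.onInfinite_comp n] at h1
  simp only [piece, projMat_zero, projMat_toE]
  exact h1

variable (s v) in
/-- The pieces of the Rauzy fractals are bounded by `K * ρ ^ n` at the level `n`. -/
def PieceBound (K ρ : ℝ) : Prop :=
  0 < K ∧ 0 < ρ ∧ ρ < 1 ∧ ∀ u, IsFixedPoint s u → ∀ n b, piece s v u n b ⊆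
    Metric.closedBall 0 (K * ρ ^ n)

lemma IsContracting.exists_pieceBound (hc : IsContracting s v)
    (hB : ∃ B : ℕ, ∀ k a, ((s k).img a).length ≤ B) : ∃ K ρ, PieceBound s v K ρ := by
  obtain ⟨K, ρ, hK0, hρ, hρ1, hK⟩ := hc.exists_norm_projMat_factor_le hB
  refine ⟨K, ρ, hK0, hρ, hρ1, fun u hu n b => closure_minimal ?_ Metric.isClosed_closedBall⟩
  rintro _ ⟨_, ⟨m, -, rfl⟩, rfl⟩
  simpa using hK u hu n m

lemma PieceBound.isCompact_piece {K ρ : ℝ} (hK : PieceBound s v K ρ) (hu : IsFixedPoint s u)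
    (n : ℕ) (b : Fin (d + 1)) : IsCompact (piece s v u n b) :=
  Metric.isCompact_of_isClosed_isBounded (isClosed_piece u n b)
    (Metric.isBounded_closedBall.subset (hK.2.2.2 u hu n b))

end

end SAdic

namespace SAdic

noncomputable section

/-! ### Kronecker's theorem -/

section Kronecker

variable {ι : Type*} [Fintype ι]

open UnitAddTorus

lemma volume_real_univ_unitAddTorus :
    (volume : Measure (UnitAddTorus ι)).real univ = 1 := by
  have : IsProbabilityMeasure (volume : Measure UnitAddCircle) := ⟨UnitAddCircle.measure_univ⟩
  exact probReal_univ

lemma mFourier_apply_add (k : ι → ℤ) (x y : UnitAddTorus ι) :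
    mFourier k (x + y) = mFourier k x * mFourier k y := by
  simp [mFourier, fourier_apply, smul_add, AddCircle.toCircle_add, Finset.prod_mul_distrib]

lemma mFourier_apply_eq (k : ι → ℤ) (x : UnitAddTorus ι) :
    mFourier k x = ((∑ i, k i • x i).toCircle : ℂ) := by
  have h1 : ∀ t : Finset ι, ((∏ i ∈ t, ((k i • x i).toCircle : ℂ))) =
      ((∑ i ∈ t, k i • x i).toCircle : ℂ) := by
    classical
    intro t
    induction t using Finset.induction_on with
    | empty => simp
    | insert a t ha ih => rw [Finset.prod_insert ha, Finset.sum_insert ha, ih,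
        AddCircle.toCircle_add, Circle.coe_mul]
  simp only [mFourier, fourier_apply, ContinuousMap.coe_mk]
  exact h1 Finset.univ

lemma mFourier_apply_nsmul (k : ι → ℤ) (n : ℕ) (x : UnitAddTorus ι) :
    mFourier k (n • x) = mFourier k x ^ n := by
  induction n with
  | zero => simp [mFourier_apply_eq]
  | succ n ih => rw [succ_nsmul, mFourier_apply_add, ih, pow_succ]

lemma norm_mFourier_apply (k : ι → ℤ) (x : UnitAddTorus ι) : ‖mFourier k x‖ = 1 := by
  rw [mFourier_apply_eq]; exact Circle.norm_coe _

/-- Translating by `θ` preserves the integral and multiplies it by `mFourier k θ ≠ 1`. -/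
lemma integral_mFourier_eq_zero {k : ι → ℤ} {θ : UnitAddTorus ι} (h : mFourier k θ ≠ 1) :
    ∫ x, mFourier k x = 0 := by
  have h1 : ∫ x, mFourier k (x + θ) = ∫ x, mFourier k x :=
    integral_add_right_eq_self (fun x => mFourier k x) θ
  simp only [mFourier_apply_add, integral_mul_const] at h1
  have h2 : (∫ x, mFourier k x) * (mFourier k θ - 1) = 0 := by rw [mul_sub, h1]; ring
  exact (mul_eq_zero.mp h2).resolve_right (sub_ne_zero.mpr h)

/-- The Birkhoff averages along the orbit of `0` of a continuous function on the torus. -/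
def orbitAverage (θ : UnitAddTorus ι) (N : ℕ) (f : C(UnitAddTorus ι, ℂ)) : ℂ :=
  (N : ℂ)⁻¹ * ∑ n ∈ Finset.range N, f (n • θ)

omit [Fintype ι] in
lemma norm_orbitAverage_le (θ : UnitAddTorus ι) (N : ℕ) (f : C(UnitAddTorus ι, ℂ)) :
    ‖orbitAverage θ N f‖ ≤ ‖f‖ := by
  rw [orbitAverage, norm_mul, norm_inv, Complex.norm_natCast]
  rcases Nat.eq_zero_or_pos N with rfl | hN
  · simp
  · have hN0 : (0 : ℝ) < N := by exact_mod_cast hN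
    rw [inv_mul_le_iff₀ hN0]
    refine (norm_sum_le _ _).trans ((Finset.sum_le_sum fun n _ => f.norm_coe_le_norm _).trans ?_)
    simp

/-- For `k ≠ 0` the averages are geometric sums of ratio `z ≠ 1` with `|z| = 1`, divided by `N`:
they are at most `2 / (‖z - 1‖ N)`. -/
lemma tendsto_orbitAverage_mFourier {θ : UnitAddTorus ι} (hθ : ∀ k ≠ 0, mFourier k θ ≠ 1)
    (k : ι → ℤ) :
    Tendsto (fun N => orbitAverage θ N (mFourier k)) atTop (𝓝 (∫ x, mFourier k x)) := by
  by_cases hk : k = 0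
  · subst hk
    simp only [orbitAverage, mFourier_zero, ContinuousMap.one_apply, Finset.sum_const,
      Finset.card_range, nsmul_eq_mul, mul_one]
    refine tendsto_const_nhds.congr' ?_
    filter_upwards [eventually_gt_atTop 0] with N hN
    have : (N : ℂ) ≠ 0 := by exact_mod_cast hN.ne'
    simp [this, volume_real_univ_unitAddTorus]
  · rw [integral_mFourier_eq_zero (hθ k hk)]
    set z := mFourier k θ with hz
    have hz1 : z - 1 ≠ 0 := sub_ne_zero.mpr (hθ k hk)
    have h1 : ∀ N, ‖orbitAverage θ N (mFourier k)‖ ≤ (2 / ‖z - 1‖) / N := by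
      intro N
      simp only [orbitAverage, mFourier_apply_nsmul, ← hz]
      rw [geom_sum_eq (hθ k hk), norm_mul, norm_inv, Complex.norm_natCast, norm_div,
        inv_mul_eq_div]
      gcongr
      refine (norm_sub_le _ _).trans ?_
      rw [norm_pow, norm_mFourier_apply]
      norm_num
    exact squeeze_zero_norm h1 (tendsto_const_div_atTop_nhds_zero_nat _)

omit [Fintype ι] in
lemma orbitAverage_add (θ : UnitAddTorus ι) (N : ℕ) (f g : C(UnitAddTorus ι, ℂ)) :
    orbitAverage θ N (f + g) = orbitAverage θ N f + orbitAverage θ N g := by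
  simp [orbitAverage, Finset.sum_add_distrib, mul_add]

omit [Fintype ι] in
lemma orbitAverage_smul (θ : UnitAddTorus ι) (N : ℕ) (c : ℂ) (f : C(UnitAddTorus ι, ℂ)) :
    orbitAverage θ N (c • f) = c * orbitAverage θ N f := by
  simp only [orbitAverage, ContinuousMap.smul_apply, smul_eq_mul, ← Finset.mul_sum]
  ring

lemma integrable_continuousMap (f : C(UnitAddTorus ι, ℂ)) : Integrable (fun x => f x) :=
  f.continuous.integrable_of_hasCompactSupport (HasCompactSupport.of_compactSpace _)

lemma tendsto_orbitAverage_of_mem_span {θ : UnitAddTorus ι} (hθ : ∀ k ≠ 0, mFourier k θ ≠ 1)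
    {p : C(UnitAddTorus ι, ℂ)} (hp : p ∈ Submodule.span ℂ (range (mFourier (d := ι)))) :
    Tendsto (fun N => orbitAverage θ N p) atTop (𝓝 (∫ x, p x)) := by
  induction hp using Submodule.span_induction with
  | mem x hx =>
    obtain ⟨k, rfl⟩ := hx
    exact tendsto_orbitAverage_mFourier hθ k
  | zero => simp [orbitAverage]
  | add f g _ _ hf hg =>
    simp only [orbitAverage_add, ContinuousMap.add_apply]
    rw [integral_add (integrable_continuousMap f) (integrable_continuousMap g)]
    exact hf.add hg
  | smul c f _ hf =>
    simp only [orbitAverage_smul, ContinuousMap.smul_apply, smul_eq_mul]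
    rw [integral_const_mul]
    exact hf.const_mul c

/-- Kronecker's theorem: a forward orbit of a translation of a torus is dense as soon as no
non-trivial character is invariant. -/
theorem denseRange_nsmul_of_mFourier_ne_one {θ : UnitAddTorus ι}
    (hθ : ∀ k ≠ 0, mFourier k θ ≠ 1) : DenseRange fun n : ℕ => n • θ := by
  by_contra hd
  obtain ⟨x₀, hx₀⟩ : ∃ x, x ∉ closure (range fun n : ℕ => n • θ) := by
    simpa [DenseRange, Dense] using hd
  set H := closure (range fun n : ℕ => n • θ) with hH
  -- The distance to the orbit closure has zero averages along the orbit. Approximating it uniformly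
  -- by trigonometric polynomials, whose averages converge to their integrals, makes its integral
  -- vanish, although it is continuous, nonnegative and positive at `x₀`.
  let f : C(UnitAddTorus ι, ℂ) := ⟨fun x => ((Metric.infDist x H : ℝ) : ℂ), by fun_prop⟩
  have hf0 : ∀ N, orbitAverage θ N f = 0 := by
    intro N
    have : ∀ n : ℕ, f (n • θ) = 0 := fun n => by
      simp only [f, ContinuousMap.coe_mk, Complex.ofReal_eq_zero]
      exact Metric.infDist_zero_of_mem (subset_closure ⟨n, rfl⟩)
    simp [orbitAverage, this]
  have hint : ∫ x, f x = 0 := by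
    rw [← norm_le_zero_iff]
    refine le_of_forall_pos_le_add fun ε hε => ?_
    have hmem : f ∈ (Submodule.span ℂ (range (mFourier (d := ι)))).topologicalClosure := by
      rw [span_mFourier_closure_eq_top]; trivial
    obtain ⟨p, hp, hfp⟩ := Metric.mem_closure_iff.mp hmem (ε / 2) (by positivity)
    rw [dist_eq_norm] at hfp
    have h1 : ‖∫ x, p x‖ ≤ ε / 2 := by
      refine le_of_tendsto (tendsto_orbitAverage_of_mem_span hθ hp).norm
        (Eventually.of_forall fun N => ?_)
      have h2 : orbitAverage θ N (p - f) = orbitAverage θ N p := by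
        have := orbitAverage_add θ N (p - f) f
        rw [sub_add_cancel, hf0, add_zero] at this
        exact this.symm
      rw [← h2]
      exact (norm_orbitAverage_le θ N _).trans (by rw [norm_sub_rev]; exact hfp.le)
    have h3 : ‖∫ x, (f - p) x‖ ≤ ε / 2 := by
      have := norm_integral_le_of_norm_le_const (μ := (volume : Measure (UnitAddTorus ι)))
        (f := fun x => (f - p) x) (C := ε / 2)
        (Eventually.of_forall fun x => ((f - p).norm_coe_le_norm x).trans hfp.le)
      simpa [volume_real_univ_unitAddTorus] using this
    have h4 : ∫ x, f x = (∫ x, (f - p) x) + ∫ x, p x := by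
      rw [← integral_add (integrable_continuousMap _) (integrable_continuousMap _)]
      simp
    rw [h4, zero_add]
    exact (norm_add_le _ _).trans (by linarith)
  have hreal : ∫ x, Metric.infDist x H = 0 := by
    have : ∫ x, f x = ((∫ x, Metric.infDist x H : ℝ) : ℂ) := integral_ofReal
    rw [this] at hint
    exact_mod_cast hint
  have hcont : Continuous fun x => Metric.infDist x H := by fun_prop
  have hpos : 0 < ∫ x, Metric.infDist x H := by
    refine hcont.integral_pos_of_hasCompactSupport_nonneg_nonzero
      (HasCompactSupport.of_compactSpace _) (fun x => Metric.infDist_nonneg) (x := x₀) ?_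
    have hne : H.Nonempty := ⟨_, subset_closure ⟨0, rfl⟩⟩
    exact ((isClosed_closure.notMem_iff_infDist_pos hne).mp hx₀).ne'
  exact hpos.ne' hreal

end Kronecker

/-! ### The lattice -/

variable {d : ℕ}

/-- The coordinates `1, …, d` on `P`. -/
def coordsP (d : ℕ) : P d ≃L[ℝ] (Fin d → ℝ) :=
  LinearEquiv.toContinuousLinearEquiv
  { toFun := fun x i => (x : E d) i.succ
    map_add' := fun x y => by funext i; simp
    map_smul' := fun c x => by funext i; simp
    invFun := fun y => ⟨WithLp.toLp 2 (Fin.cons (-∑ i, y i) y), by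
      simp [h_apply, Fin.sum_univ_succ]⟩
    left_inv := fun x => by
      have hx : (x : E d) 0 + ∑ i : Fin d, (x : E d) i.succ = 0 := by
        rw [← Fin.sum_univ_succ]; exact LinearMap.mem_ker.mp x.2
      ext i
      refine Fin.cases ?_ (fun i => ?_) i
      · simp; linarith
      · simp
    right_inv := fun y => by funext i; simp }

@[simp] lemma coordsP_apply (x : P d) (i : Fin d) : coordsP d x i = (x : E d) i.succ := rfl

lemma mem_Lam_iff (x : P d) : x ∈ Lam d ↔ ∀ i : Fin d, ∃ m : ℤ, (x : E d) i.succ = m := by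
  refine ⟨fun hx i => hx i.succ, fun hx i => ?_⟩
  refine Fin.cases ?_ hx i
  choose m hm using hx
  refine ⟨-∑ i, m i, ?_⟩
  have h0 : (x : E d) 0 + ∑ i : Fin d, (x : E d) i.succ = 0 := by
    rw [← Fin.sum_univ_succ]; exact LinearMap.mem_ker.mp x.2
  simp only [hm] at h0
  push_cast
  linarith

lemma exists_toE_of_mem_Lam {x : P d} (hx : x ∈ Lam d) :
    ∃ z : Fin (d + 1) → ℤ, ∑ i, z i = 0 ∧ (x : E d) = toE z := by
  choose m hm using hx
  have h1 : (x : E d) = toE m := by ext i; exact hm i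
  refine ⟨m, ?_, h1⟩
  have h2 : h d (x : E d) = 0 := LinearMap.mem_ker.mp x.2
  rw [h1, h_toE] at h2
  exact_mod_cast h2

instance : Countable (Lam d) := by
  have : ∀ x : Lam d, ∃ z : Fin (d + 1) → ℤ, ((x : P d) : E d) = toE z := fun x =>
    (exists_toE_of_mem_Lam x.2).imp fun _ h => h.2
  choose f hf using this
  refine Function.Injective.countable (f := f) fun x y hxy => ?_
  ext1; ext1
  rw [hf, hf, hxy]

lemma isClosed_Lam : IsClosed (Lam d : Set (P d)) := by
  have h1 : (Lam d : Set (P d)) =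
      ⋂ i, (fun x : P d => (x : E d) i) ⁻¹' range (Int.cast : ℤ → ℝ) := by
    ext x
    simp only [SetLike.mem_coe, mem_iInter, mem_preimage, mem_range]
    exact ⟨fun hx i => (hx i).imp fun _ => Eq.symm, fun hx i => (hx i).imp fun _ => Eq.symm⟩
  rw [h1]
  exact isClosed_iInter fun i => Int.isClosedEmbedding_coe_real.isClosed_range.preimage
    (by fun_prop)

/-- The vector `e_0 - v` of `P`. -/
def trans (v : Simplex d) : P d := proj v (e 0)

lemma h_e (i : Fin (d + 1)) : h d (e i) = 1 := by simp [h_apply, e, EuclideanSpace.single]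

lemma coe_trans (v : Simplex d) : (trans v : E d) = e 0 - (v : E d) := by
  rw [trans, coe_proj, h_e, one_smul]

/-- Modulo the lattice, the projection of an integer vector `z` is `h z • (e_0 - v)`. -/
lemma proj_toE_sub_mem_Lam (v : Simplex d) (z : Fin (d + 1) → ℤ) :
    proj v (toE z) - (∑ i, z i) • trans v ∈ Lam d := by
  intro i
  refine ⟨z i - (∑ j, z j) * (Pi.single 0 1 : Fin (d + 1) → ℤ) i, ?_⟩
  rw [AddSubgroupClass.coe_sub, coe_proj, ← Int.cast_smul_eq_zsmul ℝ, Submodule.coe_smul,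
    coe_trans, h_toE]
  have : (e (0 : Fin (d + 1)) : E d) i = ((Pi.single 0 1 : Fin (d + 1) → ℤ) i : ℝ) := by
    by_cases hi : i = 0
    · subst hi; simp [e]
    · simp [e, hi]
  simp only [PiLp.sub_apply, PiLp.smul_apply, smul_eq_mul, toE_apply, this]
  push_cast
  ring

/-- The orbit of the translation by `e_0 - v` is dense modulo the lattice. -/
theorem dense_nsmul_trans_add_Lam {v : Simplex d} (hv : TotallyIrrational v) :
    Dense {x : P d | ∃ n : ℕ, x - n • trans v ∈ Lam d} := by
  let c : (Fin d → ℝ) → UnitAddTorus (Fin d) := Pi.map fun _ x => (x : AddCircle (1 : ℝ))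
  have hc : IsOpenMap c := by
    refine IsOpenMap.piMap (fun _ => QuotientAddGroup.isOpenMap_coe) ?_
    exact Eventually.of_forall fun _ => QuotientAddGroup.mk_surjective
  have hφ : IsOpenMap (c ∘ coordsP d) := hc.comp (coordsP d).toHomeomorph.isOpenMap
  have hker : ∀ x y, c (coordsP d x) = c (coordsP d y) → x - y ∈ Lam d := by
    intro x y hxy
    rw [mem_Lam_iff]
    intro i
    have h1 : (((x : E d) i.succ : ℝ) : AddCircle (1 : ℝ)) = (((y : E d) i.succ : ℝ)) :=
      congrFun hxy i
    rw [← sub_eq_zero, ← AddCircle.coe_sub, AddCircle.coe_eq_zero_iff] at h1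
    obtain ⟨m, hm⟩ := h1
    exact ⟨m, by simpa using hm.symm⟩
  have hsmul : ∀ (n : ℕ) x, c (coordsP d (n • x)) = n • c (coordsP d x) := by
    intro n x
    funext i
    simp [c]
  have hdense : DenseRange fun n : ℕ => n • c (coordsP d (trans v)) := by
    refine denseRange_nsmul_of_mFourier_ne_one fun k hk hk1 => hk ?_
    rw [mFourier_apply_eq, Circle.coe_eq_one, ← AddCircle.toCircle_zero (T := (1 : ℝ))] at hk1
    have h1 := AddCircle.injective_toCircle one_ne_zero hk1
    have h2 : ((∑ i, (k i : ℝ) * (-(v : E d) i.succ) : ℝ) : AddCircle (1 : ℝ)) = 0 := by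
      rw [← h1]
      have : ∀ t : Finset (Fin d), ((∑ i ∈ t, (k i : ℝ) * (-(v : E d) i.succ) : ℝ) :
          AddCircle (1 : ℝ)) = ∑ i ∈ t, k i • c (coordsP d (trans v)) i := by
        intro t
        induction t using Finset.induction_on with
        | empty => simp
        | insert a t ha ih =>
          rw [Finset.sum_insert ha, Finset.sum_insert ha, AddCircle.coe_add, ih]
          congr 1
          simp only [c, Pi.map_apply, coordsP_apply, coe_trans]
          rw [← AddCircle.coe_zsmul, zsmul_eq_mul]
          simp [e]
      exact this _
    rw [AddCircle.coe_eq_zero_iff] at h2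
    obtain ⟨m, hm⟩ := h2
    have hv1 : ∑ i, (v : E d) i = 1 := v.2.2
    -- An invariant character gives `-∑ k_i v_{i+1} = m`. Adding `m` times `∑ v_i = 1` makes this
    -- the homogeneous relation `m v_0 + ∑ (k_i + m) v_{i+1} = 0`.
    have hli := Fintype.linearIndependent_iff.mp hv (Fin.cons (m : ℚ) fun i => (k i + m : ℚ)) (by
      rw [Fin.sum_univ_succ] at hv1 ⊢
      simp only [Fin.cons_zero, Fin.cons_succ, Rat.smul_def]
      push_cast
      simp only [add_mul, Finset.sum_add_distrib, ← Finset.mul_sum]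
      simp only [mul_neg, Finset.sum_neg_distrib, zsmul_eq_mul, mul_one] at hm
      linear_combination m * hv1 + hm)
    have hm0 : (m : ℚ) = 0 := by simpa using hli 0
    funext i
    have := hli i.succ
    simp only [Fin.cons_succ, hm0, add_zero] at this
    exact_mod_cast this
  refine (hdense.preimage hφ).mono ?_
  rintro x ⟨n, hn⟩
  exact ⟨n, hker _ _ (by rw [hsmul]; exact hn.symm)⟩

/-- The projections of the integer points of the half-space `h ≥ 0` are dense. -/
theorem dense_proj_toE {v : Simplex d} (hv : TotallyIrrational v) :
    Dense ((fun z : Fin (d + 1) → ℤ => proj v (toE z)) '' {z | 0 ≤ ∑ i, z i}) := by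
  refine (dense_nsmul_trans_add_Lam hv).mono ?_
  rintro x ⟨n, hn⟩
  obtain ⟨z, hz, hxz⟩ := exists_toE_of_mem_Lam hn
  -- With `x - n t = z` in the lattice, `z + n e_0` projects to `x` and has coordinate sum `n ≥ 0`.
  refine ⟨z + n • Pi.single 0 1, by simp [Finset.sum_add_distrib, hz, ← Finset.mul_sum], ?_⟩
  have h1 : (toE (n • Pi.single 0 1 : Fin (d + 1) → ℤ) : E d) = n • e 0 := by
    ext i
    by_cases hi : i = 0
    · subst hi; simp [e]
    · simp [e, hi]
  simp only
  rw [toE_add, map_add, h1, map_nsmul, ← hxz, proj_eq_self]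
  simp [trans]

end

end SAdic

namespace SAdic

open scoped Pointwise

noncomputable section

variable {d : ℕ}

/-! ### The torus -/

@[simp] lemma Lam_vadd_apply (g : Lam d) (x : P d) : g +ᵥ x = (g : P d) + x := rfl

/-- The vector of the lattice with prescribed coordinates `1, …, d`. -/
def latticePoint (m : Fin d → ℤ) : Lam d :=
  ⟨(coordsP d).symm fun i => (m i : ℝ), by
    rw [mem_Lam_iff]
    intro i
    refine ⟨m i, ?_⟩
    rw [← coordsP_apply, ContinuousLinearEquiv.apply_symm_apply]⟩

lemma coordsP_latticePoint (m : Fin d → ℤ) (i : Fin d) :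
    coordsP d (latticePoint m : P d) i = m i := by
  simp only [latticePoint, ContinuousLinearEquiv.apply_symm_apply]

lemma mem_unitBox_iff (x : P d) : x ∈ unitBox d ↔ ∀ i, coordsP d x i ∈ Ico (0 : ℝ) 1 := by
  constructor
  · intro hx i
    exact hx i.succ (Fin.succ_ne_zero i)
  · intro hx i hi
    obtain ⟨j, rfl⟩ := Fin.exists_succ_eq.mpr hi
    exact hx j

lemma unitBox_eq_preimage : unitBox d = coordsP d ⁻¹' univ.pi fun _ => Ico (0 : ℝ) 1 := by
  ext x
  simp only [mem_unitBox_iff, mem_preimage, mem_univ_pi]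

lemma measurableSet_unitBox : MeasurableSet (unitBox d) := by
  rw [unitBox_eq_preimage]
  exact (MeasurableSet.univ_pi fun _ => measurableSet_Ico).preimage
    (coordsP d).continuous.measurable

lemma unitBox_subset_image : unitBox d ⊆ (coordsP d).symm '' univ.pi fun _ => Icc (0 : ℝ) 1 := by
  intro x hx
  refine ⟨coordsP d x, fun i _ => Ico_subset_Icc_self ((mem_unitBox_iff x).mp hx i), by simp⟩

lemma isCompact_image_pi_Icc :
    IsCompact ((coordsP d).symm '' univ.pi fun _ => Icc (0 : ℝ) 1) :=
  (isCompact_univ_pi fun _ => isCompact_Icc).image (coordsP d).symm.continuous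

lemma volume_unitBox_lt_top : volume (unitBox d) < ⊤ :=
  (measure_mono unitBox_subset_image).trans_lt isCompact_image_pi_Icc.measure_lt_top

lemma exists_unique_vadd_mem_unitBox (x : P d) : ∃! g : Lam d, g +ᵥ x ∈ unitBox d := by
  refine ⟨latticePoint fun i => -⌊coordsP d x i⌋, ?_, fun g hg => ?_⟩
  · simp only [mem_unitBox_iff, Lam_vadd_apply, map_add, Pi.add_apply, coordsP_latticePoint]
    intro i
    have h1 := Int.floor_le (coordsP d x i)
    have h2 := Int.lt_floor_add_one (coordsP d x i)
    constructor
    · push_cast; linarith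
    · push_cast; linarith
  · simp only [mem_unitBox_iff, Lam_vadd_apply, map_add, Pi.add_apply] at hg
    ext1
    apply (coordsP d).injective
    funext i
    rw [coordsP_latticePoint]
    obtain ⟨m, hm⟩ := (mem_Lam_iff _).mp g.2 i
    rw [← coordsP_apply] at hm
    have h3 := hg i
    rw [hm] at h3 ⊢
    have : ⌊coordsP d x i⌋ = -m := by
      rw [Int.floor_eq_iff]
      push_cast
      exact ⟨by linarith [h3.1], by linarith [h3.2]⟩
    rw [this, neg_neg]

lemma isAddFundamentalDomain_unitBox :
    IsAddFundamentalDomain (Lam d) (unitBox d) (volume : Measure (P d)) :=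
  IsAddFundamentalDomain.mk' measurableSet_unitBox.nullMeasurableSet
    exists_unique_vadd_mem_unitBox

lemma volume_unitBox_ne_zero : (volume : Measure (P d)) (unitBox d) ≠ 0 :=
  isAddFundamentalDomain_unitBox.measure_ne_zero (NeZero.ne _)

lemma q_eq_q_iff {x y : P d} : q d x = q d y ↔ x - y ∈ Lam d := by
  rw [q, q, eq_comm, QuotientAddGroup.eq, neg_add_eq_sub]

lemma q_add (x y : P d) : q d (x + y) = q d x + q d y := rfl

lemma q_eq_zero {x : P d} (hx : x ∈ Lam d) : q d x = 0 :=
  (QuotientAddGroup.eq_zero_iff x).mpr hx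

lemma q_surjective : Function.Surjective (q d) := QuotientAddGroup.mk_surjective

lemma continuous_q : Continuous (q d) := continuous_quotient_mk'

lemma isOpenMap_q : IsOpenMap (q d) := QuotientAddGroup.isOpenMap_coe

instance : IsClosed (Lam d : Set (P d)) := isClosed_Lam

instance : CompactSpace (Torus d) := by
  refine ⟨?_⟩
  have h1 : (univ : Set (Torus d)) =
      q d '' ((coordsP d).symm '' univ.pi fun _ => Icc (0 : ℝ) 1) := by
    refine (eq_univ_of_forall fun z => ?_).symm
    obtain ⟨x, rfl⟩ := q_surjective z
    obtain ⟨g, hg, -⟩ := exists_unique_vadd_mem_unitBox x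
    refine ⟨_, unitBox_subset_image hg, ?_⟩
    rw [q_eq_q_iff]
    simp
  rw [h1]
  exact isCompact_image_pi_Icc.image continuous_q

instance : T2Space (Torus d) := inferInstance

instance : SecondCountableTopology (Torus d) := inferInstance

instance : PolishSpace (Torus d) := inferInstance

instance : BorelSpace (Torus d) := inferInstance

instance : StandardBorelSpace (Torus d) := inferInstance

lemma measurable_q : Measurable (q d) := continuous_q.measurable

lemma torusMeasure_apply {B : Set (Torus d)} (hB : MeasurableSet B) :
    torusMeasure d B = volume (q d ⁻¹' B ∩ unitBox d) := by
  rw [torusMeasure, Measure.map_apply measurable_q hB,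
    Measure.restrict_apply (measurable_q hB)]

instance : IsFiniteMeasure (torusMeasure d) := by
  refine ⟨?_⟩
  rw [torusMeasure_apply MeasurableSet.univ]
  exact (measure_mono inter_subset_right).trans_lt volume_unitBox_lt_top

lemma torusMeasure_univ_ne_zero : torusMeasure d univ ≠ 0 := by
  rw [torusMeasure_apply MeasurableSet.univ, preimage_univ, univ_inter]
  exact volume_unitBox_ne_zero

lemma torusMeasure_eq_zero {B : Set (Torus d)} (hB : MeasurableSet B)
    (h0 : (volume : Measure (P d)) (q d ⁻¹' B) = 0) : torusMeasure d B = 0 := by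
  rw [torusMeasure_apply hB]
  exact measure_mono_null inter_subset_left h0

/-- Translating the unit box gives another fundamental domain, and a `Λ`-invariant set has the same
measure in all of them. -/
lemma measurePreserving_add_right (t : Torus d) :
    MeasurePreserving (fun z => z + t) (torusMeasure d) (torusMeasure d) := by
  obtain ⟨x, rfl⟩ := q_surjective t
  have hm : Measurable fun z : Torus d => z + q d x := (continuous_add_const _).measurable
  refine ⟨hm, ?_⟩
  ext B hB
  rw [Measure.map_apply hm hB, torusMeasure_apply (hm hB), torusMeasure_apply hB]
  have h1 : q d ⁻¹' ((fun z => z + q d x) ⁻¹' B) ∩ unitBox d =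
      (fun y => y + x) ⁻¹' (q d ⁻¹' B ∩ (x +ᵥ unitBox d)) := by
    ext y
    simp only [mem_inter_iff, mem_preimage, q_add, mem_vadd_set_iff_neg_vadd_mem, vadd_eq_add]
    rw [show -x + (y + x) = y by abel]
  rw [h1, measure_preimage_add_right]
  refine IsAddFundamentalDomain.measure_set_eq (G := Lam d)
    (isAddFundamentalDomain_unitBox.vadd_of_comm x) isAddFundamentalDomain_unitBox
    (measurable_q hB) fun g => ?_
  ext y
  simp only [mem_preimage, Lam_vadd_apply, q_add, q_eq_zero g.2, zero_add]

/-- The forward orbits of the translation by `e_0 - v` are dense. -/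
theorem dense_orbit {v : Simplex d} (hv : TotallyIrrational v) (z : Torus d) :
    Dense (range fun n : ℕ => z + n • q d (trans v)) := by
  have h0 : Dense (range fun n : ℕ => n • q d (trans v)) := by
    have h1 := q_surjective.denseRange.dense_image continuous_q (dense_nsmul_trans_add_Lam hv)
    refine h1.mono ?_
    rintro _ ⟨x, ⟨n, hn⟩, rfl⟩
    exact ⟨n, (q_eq_q_iff.mpr hn).symm⟩
  have h2 := (Homeomorph.addLeft z).surjective.denseRange.dense_image
    (Homeomorph.addLeft z).continuous h0
  rw [← range_comp] at h2
  exact h2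

end

end SAdic

namespace SAdic

noncomputable section

variable {d : ℕ} {s : ℕ → Substitution d} {v y : Simplex d} {n : ℕ}

/-! ### The induced maps on `P` -/

variable (s v) in
/-- The restriction of `π_v M_{[0,n)}` to `P`. -/
def restrictMat (n : ℕ) : P d →ₗ[ℝ] P d := projMat s v n ∘ₗ (P d).subtype

lemma isUnit_det_comp (hs : ∀ k, (s k).IsUnimodular) (n : ℕ) : IsUnit (comp s n).mat.det :=
  Int.isUnit_iff_abs_eq.mpr (abs_det_comp s hs n)

lemma abs_det_iterMat (hs : ∀ k, (s k).IsUnimodular) (n : ℕ) : |(iterMat s n).det| = 1 := by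
  rw [iterMat_eq, ← Int.cast_det, ← Int.cast_abs, abs_det_comp s hs n, Int.cast_one]

lemma isUnit_det_iterMat (hs : ∀ k, (s k).IsUnimodular) (n : ℕ) : IsUnit (iterMat s n).det :=
  isUnit_iff_ne_zero.mpr fun h0 => by simpa [h0] using abs_det_iterMat hs n

lemma IsDirectionOf.exists_toEuclideanLin_eq (hs : ∀ k, (s k).IsUnimodular)
    (hy : IsDirectionOf y (Matrix.toEuclideanLin (iterMat s n)⁻¹ (v : E d))) :
    ∃ c : ℝ, 0 < c ∧ Matrix.toEuclideanLin (iterMat s n) (y : E d) = c • (v : E d) := by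
  obtain ⟨c, hc, hcy⟩ := hy
  refine ⟨c⁻¹, inv_pos.mpr hc, ?_⟩
  have h1 : Matrix.toEuclideanLin (iterMat s n)
      (Matrix.toEuclideanLin (iterMat s n)⁻¹ (v : E d)) = v := by
    simp [Matrix.toLpLin_apply, Matrix.mul_nonsing_inv _ (isUnit_det_iterMat hs n)]
  rw [hcy, map_smul] at h1
  rw [← h1, smul_smul, inv_mul_cancel₀ hc.ne', one_smul]

variable {c : ℝ}

lemma projMat_direction (hy : Matrix.toEuclideanLin (iterMat s n) (y : E d) = c • (v : E d)) :
    projMat s v n (y : E d) = 0 := by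
  rw [projMat, LinearMap.comp_apply, hy, map_smul, proj_self, smul_zero]

/-- As `M y` is a multiple of `v`, the map `π_v M` kills `y`; hence it factors through `π_y`. -/
lemma restrictMat_proj (hy : Matrix.toEuclideanLin (iterMat s n) (y : E d) = c • (v : E d))
    (z : E d) : restrictMat s v n (proj y z) = projMat s v n z := by
  rw [restrictMat, LinearMap.comp_apply, Submodule.subtype_apply, coe_proj, map_sub, map_smul,
    projMat_direction hy, smul_zero, sub_zero]

/-- Up to a scalar, `y` is the image of `v` under an integer matrix invertible over `ℤ`. A rational
relation for `y` becomes one for `v`, which is trivial, and invertibility brings triviality back. -/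
lemma TotallyIrrational.of_direction (hs : ∀ k, (s k).IsUnimodular) (hc : 0 < c)
    (hv : TotallyIrrational v)
    (hy : Matrix.toEuclideanLin (iterMat s n) (y : E d) = c • (v : E d)) :
    TotallyIrrational y := by
  set M := (comp s n).mat with hM
  set N := M⁻¹ with hN
  have hMN : N * M = 1 := Matrix.nonsing_inv_mul _ (isUnit_det_comp hs n)
  have hNM : M * N = 1 := Matrix.mul_nonsing_inv _ (isUnit_det_comp hs n)
  have hy1 : ∀ i, ∑ j, (M i j : ℝ) * (y : E d) j = c * (v : E d) i := by
    intro i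
    have := congrArg (fun z : E d => z i) hy
    rw [iterMat_eq] at this
    simpa [Matrix.toLpLin_apply, Matrix.mulVec, dotProduct] using this
  have hNMe : ∀ i k, ∑ j, N i j * M j k = if i = k then 1 else 0 := fun i k => by
    rw [← Matrix.mul_apply, hMN, Matrix.one_apply]
  have hMNe : ∀ i k, ∑ j, M i j * N j k = if i = k then 1 else 0 := fun i k => by
    rw [← Matrix.mul_apply, hNM, Matrix.one_apply]
  have hyv : ∀ i, (y : E d) i = c * ∑ j, (N i j : ℝ) * (v : E d) j := by
    intro i
    calc (y : E d) i = ∑ k, ((∑ j, N i j * M j k : ℤ) : ℝ) * (y : E d) k := by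
          simp [hNMe]
      _ = ∑ j, (N i j : ℝ) * ∑ k, (M j k : ℝ) * (y : E d) k := by
          push_cast
          simp only [Finset.sum_mul, Finset.mul_sum]
          rw [Finset.sum_comm]
          simp only [mul_assoc]
      _ = _ := by
          simp only [hy1, Finset.mul_sum]
          exact Finset.sum_congr rfl fun _ _ => by ring
  rw [TotallyIrrational, Fintype.linearIndependent_iff]
  intro g hg
  have h1 : ∀ j, ∑ i, g i * (N i j : ℚ) = 0 := by
    refine Fintype.linearIndependent_iff.mp hv (fun j => ∑ i, g i * (N i j : ℚ)) ?_
    simp only [Rat.smul_def, hyv] at hg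
    have h2 : c * ∑ j, ((∑ i, g i * (N i j : ℚ) : ℚ) : ℝ) * (v : E d) j = 0 := by
      rw [← hg]
      push_cast
      simp only [Finset.sum_mul, Finset.mul_sum]
      rw [Finset.sum_comm]
      refine Finset.sum_congr rfl fun _ _ => Finset.sum_congr rfl fun _ _ => by ring
    simpa [Rat.smul_def] using (mul_eq_zero.mp h2).resolve_left hc.ne'
  intro k
  calc g k = ∑ i, g i * ((∑ j, N i j * M j k : ℤ) : ℚ) := by simp [hNMe]
    _ = ∑ j, (∑ i, g i * (N i j : ℚ)) * (M j k : ℚ) := by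
        push_cast
        simp only [Finset.sum_mul, Finset.mul_sum]
        rw [Finset.sum_comm]
        simp only [mul_assoc]
    _ = 0 := by simp [h1]

/-! ### Volume scaling of the induced maps -/

lemma finrank_quotient_P : Module.finrank ℝ (E d ⧸ P d) = 1 := by
  have hsurj : Function.Surjective (h d) := fun r => ⟨r • e 0, by simp [h_e]⟩
  rw [((h d).quotKerEquivOfSurjective hsurj).finrank_eq, Module.finrank_self]

/-- `M` has determinant `±1` and multiplies by `c` from the line of `y` to that of `v`, both
normalized by `h = 1`; so it must scale the transverse volume by `1 / c`. To compare genuine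
endomorphisms, `M` is corrected by a transvection along `v`. -/
lemma abs_det_restrictMat_mul (hs : ∀ k, (s k).IsUnimodular)
    (hy : Matrix.toEuclideanLin (iterMat s n) (y : E d) = c • (v : E d)) :
    |LinearMap.det (restrictMat s v n)| * |c| = 1 := by
  set M := Matrix.toEuclideanLin (iterMat s n) with hM
  set N := Matrix.toEuclideanLin (iterMat s n)⁻¹ with hN
  have hNM : ∀ z, N (M z) = z := fun z => by
    simp [hM, hN, Matrix.toLpLin_apply, Matrix.nonsing_inv_mul _ (isUnit_det_iterMat hs n)]
  -- Chosen so that `G z = π_v M z + c h(z) v`. This `G` preserves `P`, restricts there to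
  -- `restrictMat`, acts on the quotient by `c`, and has the determinant of `M` because `f v = 0`.
  set f : E d →ₗ[ℝ] ℝ := c • (h d ∘ₗ N) - h d with hf
  set G : E d →ₗ[ℝ] E d := LinearMap.transvection f (v : E d) ∘ₗ M with hG
  have hNv : c • N (v : E d) = y := by rw [← map_smul, ← hy, hNM]
  have hfv : f v = 0 := by
    have : f v = h d (c • N (v : E d)) - h d v := by simp [hf]
    rw [this, hNv, y.2.2, v.2.2, sub_self]
  have hGz : ∀ z, G z = (projMat s v n z : E d) + (c * h d z) • (v : E d) := by
    intro z
    have : (projMat s v n z : E d) = M z - h d (M z) • (v : E d) := rfl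
    rw [this]
    simp only [hG, LinearMap.comp_apply, LinearMap.transvection.apply, hf, LinearMap.sub_apply,
      LinearMap.smul_apply, hNM, smul_eq_mul, sub_smul]
    abel
  have hPG : P d ≤ (P d).comap G := by
    intro x hx
    rw [Submodule.mem_comap, hGz, LinearMap.mem_ker.mp hx]
    simp
  have hdet := LinearMap.det_eq_det_mul_det (P d) G hPG
  have h1 : G.restrict hPG = restrictMat s v n := by
    ext1 x
    ext1
    rw [LinearMap.coe_restrict_apply, hGz, LinearMap.mem_ker.mp x.2]
    simp [restrictMat]
  have h2 : (P d).mapQ (P d) G hPG = c • LinearMap.id := by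
    refine Submodule.linearMap_qext _ ?_
    ext1 z
    simp only [LinearMap.comp_apply, Submodule.mkQ_apply, Submodule.mapQ_apply,
      LinearMap.smul_apply, LinearMap.id_apply]
    rw [← Submodule.Quotient.mk_smul, Submodule.Quotient.eq, hGz, LinearMap.mem_ker]
    have := LinearMap.mem_ker.mp (projMat s v n z).2
    simp [this, v.2.2]
  have h3 : LinearMap.det G = (iterMat s n).det := by
    rw [hG, LinearMap.det_comp, LinearMap.transvection.det, hfv, add_zero, one_mul, hM,
      LinearMap.det_toLpLin]
  rw [h1, h2, h3, LinearMap.det_smul, LinearMap.det_id, finrank_quotient_P, pow_one,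
    mul_one] at hdet
  rw [← abs_mul, ← hdet, abs_det_iterMat hs n]

lemma det_restrictMat_ne_zero (hs : ∀ k, (s k).IsUnimodular)
    (hy : Matrix.toEuclideanLin (iterMat s n) (y : E d) = c • (v : E d)) :
    LinearMap.det (restrictMat s v n) ≠ 0 := by
  intro h0
  simpa [h0] using abs_det_restrictMat_mul hs hy

lemma restrictMat_injective (hs : ∀ k, (s k).IsUnimodular)
    (hy : Matrix.toEuclideanLin (iterMat s n) (y : E d) = c • (v : E d)) :
    Function.Injective (restrictMat s v n) :=
  ((restrictMat s v n).equivOfDetNeZero (det_restrictMat_ne_zero hs hy)).injective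

lemma h_toEuclideanLin_iterMat (z : E d) :
    h d (Matrix.toEuclideanLin (iterMat s n) z) = ∑ b, ((comp s n).img b).length * z b := by
  have h1 : ∀ b, (((comp s n).img b).length : ℝ) = ∑ a, ((comp s n).mat a b : ℝ) := by
    intro b
    have := sum_ab ((comp s n).img b)
    rw [← Int.cast_natCast, ← this, Int.cast_sum]
    rfl
  simp only [h1, Finset.sum_mul]
  rw [Finset.sum_comm, h_apply, iterMat_eq]
  simp [Matrix.toLpLin_apply, Matrix.mulVec, dotProduct]

/-- Applying `h` to `M y = c v` gives `c = ∑ |s_{[0,n)}(b)| y_b ≤ ∑ |s_{[0,n)}(b)|`. Thus the floors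
are numerous enough to compensate the shrinking of a ball inside each of them. -/
lemma one_le_sum_length_mul_abs_det (hs : ∀ k, (s k).IsUnimodular) (hc : 0 < c)
    (hy : Matrix.toEuclideanLin (iterMat s n) (y : E d) = c • (v : E d)) :
    1 ≤ ∑ b, ((comp s n).img b).length * |LinearMap.det (restrictMat s v n)| := by
  have h1 := h_toEuclideanLin_iterMat (s := s) (n := n) (y : E d)
  rw [hy, map_smul, v.2.2, smul_eq_mul, mul_one] at h1
  have h2 : c ≤ ∑ b, (((comp s n).img b).length : ℝ) := by
    rw [h1]
    refine Finset.sum_le_sum fun b _ => mul_le_of_le_one_right (by positivity) ?_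
    have h3 : h d (y : E d) = 1 := y.2.2
    refine le_trans ?_ h3.le
    rw [h_apply]
    exact Finset.single_le_sum (f := fun i => (y : E d) i) (fun i _ => y.2.1 i)
      (Finset.mem_univ b)
  rw [← Finset.sum_mul, ← abs_det_restrictMat_mul hs hy, abs_of_pos hc, mul_comm]
  gcongr

end

end SAdic

namespace SAdic

noncomputable section

variable {d : ℕ} {s : ℕ → Substitution d} {v y : Simplex d} {n : ℕ} {r : ℝ}
  {u : ℕ → ℕ → Fin (d + 1)} {K ρ : ℝ}

/-! ### Levels at which the worm contains balls -/

/-- At the level `n`, each piece of the worm of `u_n` contains all the integer points of the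
half-space that project to some ball of radius `r`. -/
def HasBalls (s : ℕ → Substitution d) (v : Simplex d) (u : ℕ → ℕ → Fin (d + 1)) (r : ℝ)
    (n : ℕ) : Prop :=
  ∃ (y : Simplex d) (c : ℝ), 0 < c ∧
    Matrix.toEuclideanLin (iterMat s n) (y : E d) = c • (v : E d) ∧
    ∀ a, ∃ p : P d, ∀ z : Fin (d + 1) → ℤ, 0 ≤ ∑ i, z i →
      norm1 ((proj y (toE z) : E d) - (p : E d)) < r → z ∈ wormPiece (u n) a

lemma IsGoodWithDirection.exists_frequently_hasBalls (hs : ∀ k, (s k).IsUnimodular)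
    (hv : IsGoodWithDirection s v) :
    ∃ u, IsFixedPoint s u ∧ ∃ r, 0 < r ∧ ∃ᶠ n in atTop, HasBalls s v u r n := by
  obtain ⟨u, k, r, y, hu, hk, hr, hy, hballs, -⟩ := hv.balls
  refine ⟨u, hu, r, hr, ?_⟩
  refine hk.tendsto_atTop.frequently (Eventually.of_forall fun n => ?_).frequently
  obtain ⟨c, hc, hcy⟩ := (hy n).exists_toEuclideanLin_eq hs
  exact ⟨y n, c, hc, hcy, hballs n⟩

/-- Open balls of `P` for the `1`-norm. -/
def ball1 (p : P d) (r : ℝ) : Set (P d) := {x | norm1 ((x : E d) - (p : E d)) < r}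

lemma isOpen_ball1 (p : P d) (r : ℝ) : IsOpen (ball1 p r) :=
  isOpen_lt (continuous_norm1.comp (by fun_prop)) continuous_const

lemma mem_ball1_self (p : P d) (hr : 0 < r) : p ∈ ball1 p r := by
  simpa [ball1, norm1] using hr

lemma norm_le_of_mem_ball1 {p x : P d} (hx : x ∈ ball1 p r) : ‖x‖ ≤ r + ‖p‖ := by
  have h1 : ‖x - p‖ ≤ r := by
    rw [Submodule.coe_norm]
    exact (norm_le_norm1 _).trans (le_of_lt hx)
  calc ‖x‖ = ‖(x - p) + p‖ := by rw [sub_add_cancel]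
    _ ≤ _ := (norm_add_le _ _).trans (by linarith)

variable {c : ℝ}

/-- Integer points of the half-space project densely along the totally irrational `y`. Those
projecting into the ball lie in the worm, and their images are dense in the image of the ball. -/
lemma image_ball1_subset_piece (hirr : TotallyIrrational y)
    (hy : Matrix.toEuclideanLin (iterMat s n) (y : E d) = c • (v : E d)) {p : P d}
    {b : Fin (d + 1)} (hp : ∀ z : Fin (d + 1) → ℤ, 0 ≤ ∑ i, z i →
      norm1 ((proj y (toE z) : E d) - (p : E d)) < r → z ∈ wormPiece (u n) b) :
    restrictMat s v n '' ball1 p r ⊆ piece s v u n b := by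
  have hcont : Continuous (restrictMat s v n) := LinearMap.continuous_of_finiteDimensional _
  rintro _ ⟨x, hx, rfl⟩
  have h1 : x ∈ closure (ball1 p r ∩
      ((fun z : Fin (d + 1) → ℤ => proj y (toE z)) '' {z | 0 ≤ ∑ i, z i})) := by
    refine (isOpen_ball1 p r).inter_closure ⟨hx, ?_⟩
    rw [(dense_proj_toE hirr).closure_eq]
    trivial
  refine closure_mono ?_ (image_closure_subset_closure_image hcont (mem_image_of_mem _ h1))
  rintro _ ⟨_, ⟨hz1, ⟨z, hz0, rfl⟩⟩, rfl⟩
  exact ⟨z, hp z hz0 hz1, (restrictMat_proj hy _).symm⟩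

lemma isOpen_image_restrictMat (hs : ∀ k, (s k).IsUnimodular)
    (hy : Matrix.toEuclideanLin (iterMat s n) (y : E d) = c • (v : E d)) {B : Set (P d)}
    (hB : IsOpen B) : IsOpen (restrictMat s v n '' B) :=
  ((restrictMat s v n).equivOfDetNeZero
    (det_restrictMat_ne_zero hs hy)).toContinuousLinearEquiv.toHomeomorph.isOpenMap B hB

lemma HasBalls.interior_piece_nonempty (hs : ∀ k, (s k).IsUnimodular)
    (hv : TotallyIrrational v) (hr : 0 < r) (hn : HasBalls s v u r n) (b : Fin (d + 1)) :
    (interior (piece s v u n b)).Nonempty := by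
  obtain ⟨y, c, hc, hy, hballs⟩ := hn
  obtain ⟨p, hp⟩ := hballs b
  have h1 := image_ball1_subset_piece (hv.of_direction hs hc hy) hy hp
  exact ⟨_, interior_maximal h1 (isOpen_image_restrictMat hs hy (isOpen_ball1 p r))
    (mem_image_of_mem _ (mem_ball1_self p hr))⟩

lemma exists_frequently_small (hρ : 0 < ρ) (hρ1 : ρ < 1) {p : ℕ → Prop}
    (hp : ∃ᶠ n in atTop, p n) {ε : ℝ} (hε : 0 < ε) : ∃ n, p n ∧ K * ρ ^ n < ε := by
  have h1 : Tendsto (fun n : ℕ => K * ρ ^ n) atTop (𝓝 (K * 0)) :=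
    (tendsto_pow_atTop_nhds_zero_of_lt_one hρ.le hρ1).const_mul K
  rw [mul_zero] at h1
  exact (hp.and_eventually (h1.eventually (gt_mem_nhds hε))).exists

/-- The pieces of the Rauzy fractal are the closures of their interiors. -/
theorem piece_zero_eq_closure_interior (hs : ∀ k, (s k).IsUnimodular) (hv : TotallyIrrational v)
    (hK : PieceBound s v K ρ) (hu : IsFixedPoint s u) (hr : 0 < r)
    (hballs : ∃ᶠ n in atTop, HasBalls s v u r n) (a : Fin (d + 1)) :
    piece s v u 0 a = closure (interior (piece s v u 0 a)) := by
  refine Subset.antisymm (fun x hx => ?_)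
    ((isClosed_piece u 0 a).closure_subset_iff.mpr interior_subset)
  rw [Metric.mem_closure_iff]
  intro ε hε
  obtain ⟨hK0, hρ, hρ1, hKb⟩ := hK
  -- At such a level, `x` lies in a translate, of diameter less than `ε`, of a piece with nonempty
  -- interior, and this translate is contained in `piece s v u 0 a`.
  obtain ⟨n, hn, hnε⟩ := exists_frequently_small (K := K) hρ hρ1 hballs (half_pos hε)
  obtain ⟨b, j, hja, hxj⟩ := (hu.mem_piece_zero n a x).mp hx
  obtain ⟨x', hx'⟩ := hn.interior_piece_nonempty hs hv hr b
  set w := proj v (toE (ab (((comp s n).img b).take j))) with hw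
  refine ⟨x' + w, ?_, ?_⟩
  · have hop : IsOpen ((Homeomorph.addRight w) '' interior (piece s v u n b)) :=
      (Homeomorph.addRight w).isOpenMap _ isOpen_interior
    refine interior_maximal ?_ hop ⟨x', hx', rfl⟩
    rintro _ ⟨x'', hx'', rfl⟩
    refine (hu.mem_piece_zero n a _).mpr ⟨b, j, hja, ?_⟩
    change x'' + w - w ∈ _
    rw [add_sub_cancel_right]
    exact interior_subset hx''
  · have h1 := hKb u hu n b hxj
    have h2 := hKb u hu n b (interior_subset hx')
    rw [mem_closedBall_zero_iff] at h1 h2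
    rw [dist_eq_norm, show x - (x' + w) = (x - w) - x' by abel]
    refine (norm_sub_le _ _).trans_lt ?_
    linarith

/-- All the letters occur in the words of a fixed point. -/
lemma HasBalls.exists_letter {u' : ℕ → ℕ → Fin (d + 1)} (hs : ∀ k, (s k).IsUnimodular)
    (hv : TotallyIrrational v) (hK : PieceBound s v K ρ) (hu' : IsFixedPoint s u')
    (hn : HasBalls s v u r n) (b : Fin (d + 1)) : ∃ m, u' n m = b := by
  obtain ⟨y, c, hc, hy, -⟩ := hn
  by_contra! hb
  have hcount : ∀ m, ab (factor (u' n) 0 m) b = 0 := by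
    intro m
    simp only [ab, Nat.cast_eq_zero, List.count_eq_zero]
    simp only [factor, List.mem_map, List.mem_range, not_exists, not_and, zero_add]
    exact fun i _ => hb i
  obtain ⟨L, -, hL⟩ := (restrictMat s v n).exists_antilipschitzWith
    (LinearMap.ker_eq_bot.mpr (restrictMat_injective hs hy))
  have hyb : (y : E d) b ≠ 0 := (hv.of_direction hs hc hy).ne_zero b
  have hyb0 : 0 < (y : E d) b := lt_of_le_of_ne (y.2.1 b) hyb.symm
  -- If `b` never occurs, the `b`-coordinate of the projected prefix of length `m` is `-m y_b`. It
  -- must stay bounded, because `restrictMat` is injective and the pieces are bounded.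
  have hbound : ∀ m : ℕ, m * (y : E d) b ≤ L * (K * ρ ^ n) := by
    intro m
    set x := proj y (toE (ab (factor (u' n) 0 m))) with hx
    have h1 : restrictMat s v n x ∈ piece s v u' n (u' n m) := by
      rw [restrictMat_proj hy]
      exact subset_closure ⟨_, ⟨m, rfl, rfl⟩, rfl⟩
    have h2 := hK.2.2.2 u' hu' n _ h1
    rw [mem_closedBall_zero_iff] at h2
    have h3 : ‖x‖ ≤ L * ‖restrictMat s v n x‖ := by
      simpa [dist_zero_right] using hL.le_mul_dist x 0
    have h4 : |(x : E d) b| ≤ ‖x‖ := by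
      rw [Submodule.coe_norm, ← Real.norm_eq_abs]
      exact PiLp.norm_apply_le _ b
    have h5 : (x : E d) b = -(m * (y : E d) b) := by
      rw [hx, coe_proj, h_toE_ab, length_factor]
      simp [hcount]
    rw [h5, abs_neg, abs_of_nonneg (by positivity)] at h4
    exact h4.trans (h3.trans (by gcongr))
  obtain ⟨m, hm⟩ := exists_nat_gt (L * (K * ρ ^ n) / (y : E d) b)
  rw [div_lt_iff₀ hyb0] at hm
  exact absurd (hbound m) (not_le.mpr hm)

/-- The pieces of the Rauzy fractal do not depend on the fixed point. -/
theorem piece_zero_subset {u₁ u₂ : ℕ → ℕ → Fin (d + 1)} (hs : ∀ k, (s k).IsUnimodular)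
    (hv : TotallyIrrational v) (hK : PieceBound s v K ρ) (hu₁ : IsFixedPoint s u₁)
    (hu₂ : IsFixedPoint s u₂) (hballs : ∃ᶠ n in atTop, HasBalls s v u r n) (a : Fin (d + 1)) :
    piece s v u₁ 0 a ⊆ piece s v u₂ 0 a := by
  intro x hx
  rw [← (isClosed_piece u₂ 0 a).closure_eq, Metric.mem_closure_iff]
  intro ε hε
  obtain ⟨hK0, hρ, hρ1, hKb⟩ := id hK
  obtain ⟨n, hn, hnε⟩ := exists_frequently_small (K := K) hρ hρ1 hballs (half_pos hε)
  obtain ⟨b, j, hja, hxj⟩ := (hu₁.mem_piece_zero n a x).mp hx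
  -- The translation by the prefix of `s_{[0,n)}(b)` is independent of the fixed point: any point of
  -- the corresponding piece of `u₂`, translated likewise, is within `ε` of `x`.
  obtain ⟨m, hm⟩ := hn.exists_letter hs hv hK hu₂ b
  obtain ⟨x', hx'⟩ : (piece s v u₂ n b).Nonempty :=
    ⟨_, subset_closure ⟨_, ⟨m, hm, rfl⟩, rfl⟩⟩
  set w := proj v (toE (ab (((comp s n).img b).take j))) with hw
  refine ⟨x' + w, (hu₂.mem_piece_zero n a _).mpr ⟨b, j, hja, by rwa [← hw, add_sub_cancel_right]⟩, ?_⟩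
  have h1 := hKb u₁ hu₁ n b hxj
  have h2 := hKb u₂ hu₂ n b hx'
  rw [mem_closedBall_zero_iff] at h1 h2
  rw [dist_eq_norm, show x - (x' + w) = (x - w) - x' by abel]
  refine (norm_sub_le _ _).trans_lt ?_
  linarith

end

end SAdic

namespace SAdic

open scoped Pointwise

noncomputable section

variable {d : ℕ} {s : ℕ → Substitution d} {v y : Simplex d} {n : ℕ} {r : ℝ}
  {u : ℕ → ℕ → Fin (d + 1)} {K ρ : ℝ}

/-! ### The tilings -/

variable (s v u) in
/-- The set of the indices `(b, j, g)` of the tiles `piece n b + j (e_0 - v) + g` of level `n`,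
with `j < |s_{[0,n)}(b)|` and `g ∈ Λ`, that contain `x`. -/
def hits (n : ℕ) (x : P d) : Set (Fin (d + 1) × ℕ × Lam d) :=
  {τ | τ.2.1 < ((comp s n).img τ.1).length ∧
    x - τ.2.1 • trans v - (τ.2.2 : P d) ∈ piece s v u n τ.1}

variable (s v u) in
/-- The set of the points that are contained in at most one tile of level `n`. -/
def simpleSet (n : ℕ) : Set (P d) := {x | (hits s v u n x).Subsingleton}

lemma proj_toE_ab_sub_mem_Lam (l : List (Fin (d + 1))) :
    proj v (toE (ab l)) - l.length • trans v ∈ Lam d := by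
  have := proj_toE_sub_mem_Lam v (ab l)
  rwa [sum_ab, natCast_zsmul] at this

/-- A finite word extended to an infinite one. -/
def extend (l : List (Fin (d + 1))) (i : ℕ) : Fin (d + 1) := l.getD i 0

lemma extend_apply (l : List (Fin (d + 1))) (i : ℕ) (hi : i < l.length) : extend l i = l[i] := by
  simp [extend, hi]

lemma factor_extend (l : List (Fin (d + 1))) (i : ℕ) (hi : i ≤ l.length) :
    factor (extend l) 0 i = l.take i := by
  apply List.ext_getElem
  · simpa using hi
  · intro j h1 h2
    rw [length_factor] at h1
    rw [getElem_factor, zero_add, extend_apply _ _ (by omega)]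
    simp

/-- Every tile of level `n` that contains `x` contains a tile of level `n + 1` that contains
`x`. -/
lemma exists_mem_hits_succ (hu : IsFixedPoint s u) {x : P d} {b : Fin (d + 1)} {j : ℕ} {g : Lam d}
    (hτ : (b, j, g) ∈ hits s v u n x) :
    ∃ c, ∃ i : Fin ((s n).img c).length, ((s n).img c)[i] = b ∧ ∃ δ : Lam d,
      (δ : P d) = proj v (toE (ab ((comp s n).onWord (((s n).img c).take i)))) -
        ((comp s n).onWord (((s n).img c).take i)).length • trans v ∧
      (c, j + ((comp s n).onWord (((s n).img c).take i)).length, g + δ) ∈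
        hits s v u (n + 1) x := by
  obtain ⟨hj, hx⟩ := hτ
  obtain ⟨c, i, hib, hxi⟩ := (hu.mem_piece_succ n b _).mp hx
  refine ⟨c, i, hib, ⟨_, proj_toE_ab_sub_mem_Lam _⟩, rfl, ?_, ?_⟩
  · have h1 := (comp s n).pos_succ (extend ((s n).img c)) i
    have h2 := (comp s n).pos_mono (extend ((s n).img c)) (Nat.succ_le_of_lt i.2)
    rw [Nat.succ_eq_add_one, h1, extend_apply _ _ i.2] at h2
    simp only [Substitution.pos] at h2
    rw [factor_extend _ _ i.2.le, factor_extend _ _ le_rfl, List.take_length, ← comp_succ_img]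
      at h2
    have hib' : ((s n).img c)[(i : ℕ)] = b := hib
    rw [hib'] at h2
    simp only at hj ⊢
    omega
  · simp only [projMat_toE, ← Substitution.ab_onWord] at hxi
    convert hxi using 1
    simp only [AddSubgroup.coe_add, add_smul]
    abel

/-- Two tiles of level `n` at `x` refine to tiles of level `n + 1` at `x`, which coincide.
Uniqueness of the block and offset of a position in `s_{[0,n+1)}(c)` then recovers the original
tiles. -/
lemma simpleSet_succ_subset (hu : IsFixedPoint s u) (n : ℕ) :
    simpleSet s v u (n + 1) ⊆ simpleSet s v u n := by
  rintro x hx ⟨b, j, g⟩ hτ ⟨b', j', g'⟩ hτ'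
  obtain ⟨c, i, hib, δ, hδ, hmem⟩ := exists_mem_hits_succ hu hτ
  obtain ⟨c', i', hib', δ', hδ', hmem'⟩ := exists_mem_hits_succ hu hτ'
  have heq := hx hmem hmem'
  simp only [Prod.mk.injEq] at heq
  obtain ⟨rfl, hj, hg⟩ := heq
  have hw : ∀ i : Fin ((s n).img c).length,
      ((comp s n).onWord (((s n).img c).take i)).length =
        (comp s n).pos (extend ((s n).img c)) i := fun i => by
    rw [Substitution.pos, factor_extend _ _ i.2.le]
  have hinj := (comp s n).pos_add_inj (extend ((s n).img c)) (i := i) (j := j) (i' := i') (j' := j')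
    (by rw [extend_apply _ _ i.2, show ((s n).img c)[(i : ℕ)] = b from hib]; exact hτ.1)
    (by rw [extend_apply _ _ i'.2, show ((s n).img c)[(i' : ℕ)] = b' from hib']; exact hτ'.1)
    (by rw [← hw, ← hw]; omega)
  obtain ⟨hi, rfl⟩ := hinj
  obtain rfl : i = i' := Fin.ext hi
  obtain rfl : b = b' := hib.symm.trans hib'
  obtain rfl : δ = δ' := Subtype.ext (hδ.trans hδ'.symm)
  rw [add_right_cancel hg]

lemma simpleSet_antitone (hu : IsFixedPoint s u) : Antitone (simpleSet s v u) :=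
  antitone_nat_of_succ_le (simpleSet_succ_subset hu)

lemma measurableSet_hits (n : ℕ) (τ : Fin (d + 1) × ℕ × Lam d) :
    MeasurableSet {x | τ ∈ hits s v u n x} := by
  refine (MeasurableSet.const _).inter ?_
  exact ((isClosed_piece u n τ.1).preimage
    (f := fun x : P d => x - τ.2.1 • trans v - (τ.2.2 : P d)) (by fun_prop)).measurableSet

lemma measurableSet_simpleSet (n : ℕ) : MeasurableSet (simpleSet s v u n) := by
  have h1 : simpleSet s v u n =
      ⋂ τ : Fin (d + 1) × ℕ × Lam d, ⋂ τ' : Fin (d + 1) × ℕ × Lam d, ⋂ _ : τ ≠ τ',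
        ({x | τ ∈ hits s v u n x} ∩ {x | τ' ∈ hits s v u n x})ᶜ := by
    ext x
    simp only [simpleSet, Set.Subsingleton, mem_ofPred_eq, mem_iInter, mem_compl_iff, mem_inter_iff]
    constructor
    · exact fun hx τ τ' hne hh => hne (hx hh.1 hh.2)
    · intro hx τ hτ τ' hτ'
      by_contra hne
      exact hx τ τ' hne ⟨hτ, hτ'⟩
  rw [h1]
  exact MeasurableSet.iInter fun τ => MeasurableSet.iInter fun τ' => MeasurableSet.iInter fun _ =>
    ((measurableSet_hits n τ).inter (measurableSet_hits n τ')).compl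

lemma mem_hits_add_Lam {x : P d} (g : Lam d) {b : Fin (d + 1)} {j : ℕ} {g' : Lam d} :
    (b, j, g') ∈ hits s v u n ((g : P d) + x) ↔ (b, j, g' - g) ∈ hits s v u n x := by
  simp only [hits, mem_ofPred_eq, AddSubgroup.coe_sub]
  rw [show (g : P d) + x - j • trans v - (g' : P d) = x - j • trans v - ((g' : P d) - g) by abel]

lemma add_Lam_mem_simpleSet {x : P d} (g : Lam d) :
    (g : P d) + x ∈ simpleSet s v u n ↔ x ∈ simpleSet s v u n := by
  constructor
  · rintro hx ⟨b, j, g₁⟩ h₁ ⟨b', j', g₂⟩ h₂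
    have := hx (x := (b, j, g₁ + g)) (y := (b', j', g₂ + g))
    simp only [mem_hits_add_Lam, add_sub_cancel_right, Prod.mk.injEq, add_left_inj] at this
    simpa using this h₁ h₂
  · rintro hx ⟨b, j, g₁⟩ h₁ ⟨b', j', g₂⟩ h₂
    rw [mem_hits_add_Lam] at h₁ h₂
    simpa using hx h₁ h₂

/-! ### Almost every point of a core is simple -/

variable {c : ℝ}

/-- A core of a tile meets only finitely many of the points that are dense in another tile. -/
lemma finite_core_inter (hs : ∀ k, (s k).IsUnimodular) (hc : 0 < c)
    (hy : Matrix.toEuclideanLin (iterMat s n) (y : E d) = c • (v : E d)) {p : P d}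
    {b b' : Fin (d + 1)} (hp : ∀ z : Fin (d + 1) → ℤ, 0 ≤ ∑ i, z i →
      norm1 ((proj y (toE z) : E d) - (p : E d)) < r → z ∈ wormPiece (u n) b)
    {j j' : ℕ} {g' : Lam d} (hj : j < ((comp s n).img b).length)
    (hj' : j' < ((comp s n).img b').length) (hne : (b', j', g') ≠ (b, j, 0)) :
    ({x | x - j • trans v ∈ restrictMat s v n '' ball1 p r} ∩
      {x | x - j' • trans v - (g' : P d) ∈
        (fun z => projMat s v n (toE z)) '' wormPiece (u n) b'}).Finite := by
  set M := (comp s n).mat with hM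
  have hNM : M * M⁻¹ = 1 := Matrix.mul_nonsing_inv _ (isUnit_det_comp hs n)
  set f : P d →ₗ[ℝ] ℝ := h d ∘ₗ Matrix.toEuclideanLin (iterMat s n) ∘ₗ (P d).subtype with hf
  set H : ℝ := ‖f.toContinuousLinearMap‖ * (r + ‖p‖) with hH
  have hfH : ∀ x ∈ ball1 p r, f x ≤ H := fun x hx =>
    calc f x ≤ ‖f.toContinuousLinearMap x‖ := le_abs_self _
      _ ≤ _ := (f.toContinuousLinearMap.le_opNorm x).trans
        (mul_le_mul_of_nonneg_left (norm_le_of_mem_ball1 hx)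
          (ContinuousLinearMap.opNorm_nonneg _))
  -- Enumerates the dense points of the other tile; it is enough to bound the index `i'` of those
  -- falling in the core.
  set F : ℕ → P d := fun i => projMat s v n (toE (ab (factor (u n) 0 i))) + j' • trans v + g'
    with hF
  refine ((Set.finite_Iic ⌊H + j⌋₊).image F).subset ?_
  rintro x ⟨⟨p', hp', hxp'⟩, ⟨_, ⟨i', hi', rfl⟩, hxw⟩⟩
  refine ⟨i', ?_, by simp only [hF]; simp only at hxw; rw [hxw]; abel⟩
  set w' := ab (factor (u n) 0 i') with hw'
  set l := ((comp s n).img b).take j with hl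
  set l' := ((comp s n).img b').take j' with hl'
  have hlen : l.length = j := by simp [hl, hj.le]
  have hlen' : l'.length = j' := by simp [hl', hj'.le]
  have hδ := proj_toE_ab_sub_mem_Lam (v := v) l
  have hδ' := proj_toE_ab_sub_mem_Lam (v := v) l'
  rw [hlen] at hδ
  rw [hlen'] at hδ'
  obtain ⟨κ, hκ0, hκ⟩ := exists_toE_of_mem_Lam
    ((Lam d).add_mem ((Lam d).sub_mem g'.2 hδ') hδ)
  -- An integer lift of the core point: `π_v W = x - j t`. Unimodularity makes `w = M⁻¹ W` integral,
  -- and `π_y w = p'` lies in the ball.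
  set W := M.mulVec w' + ab l' - ab l + κ with hW
  set w := M⁻¹.mulVec W with hw
  have hMw : M.mulVec w = W := by rw [hw, Matrix.mulVec_mulVec, hNM, Matrix.one_mulVec]
  have hprojW : proj v (toE W) = x - j • trans v := by
    rw [hW, toE_add, toE_sub, toE_add, map_add, map_sub, map_add, ← projMat_toE, ← hκ,
      proj_eq_self]
    simp only at hxw
    rw [hxw]
    abel
  have hprojw : proj y (toE w) = p' := by
    apply restrictMat_injective hs hy
    rw [restrictMat_proj hy, projMat_toE, hMw, hprojW, hxp']
  have hsumW : ∑ i, W i = (comp s n).pos (u n) i' + j' - j := by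
    have h1 : M.mulVec w' = ab ((comp s n).onWord (factor (u n) 0 i')) :=
      (Substitution.ab_onWord _ _).symm
    rw [hW, h1]
    simp only [Pi.add_apply, Pi.sub_apply, Finset.sum_add_distrib, Finset.sum_sub_distrib, sum_ab,
      hlen, hlen', hκ0, Substitution.pos, add_zero]
  -- Otherwise `w` is itself a prefix of `u_n` followed by `b`. Then `pos i' + j'` and `pos i + j`
  -- are the same position of the image word, so the two tiles have the same base letter and floor,
  -- and `κ = 0` makes the lattice vectors agree too.
  have hneg : ∑ i, w i < 0 := by
    by_contra! hpos
    obtain ⟨i, hi, hwi⟩ := hp w hpos (by rw [hprojw]; exact hp')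
    have h2 : M.mulVec w = ab ((comp s n).onWord (factor (u n) 0 i)) := by
      rw [hwi]; exact (Substitution.ab_onWord _ _).symm
    have h3 : ∑ k, W k = (comp s n).pos (u n) i := by
      rw [← hMw, h2, sum_ab]; rfl
    have h4 := (comp s n).pos_add_inj (u n) (i := i') (j := j') (i' := i) (j' := j)
      (by rwa [hi']) (by rwa [hi]) (by omega)
    obtain ⟨rfl, rfl⟩ := h4
    obtain rfl : b = b' := hi.symm.trans hi'
    have h5 : κ = 0 := by
      have h6 : M.mulVec w' = W := by rw [hw', ← hwi, hMw]
      rw [hW, hl', hl] at h6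
      simpa using h6
    rw [h5, toE_zero, hl', hl, sub_add_cancel] at hκ
    exact hne (by simpa using hκ)
  -- Evaluating `h` on `W = M w` with `w = p' + h(w) y` gives an upper bound on `h(W) = pos i' + j'
  -- - j`, since `h(w) < 0` and `p'` stays in a ball; hence `i'` is bounded.
  have hhW : ((∑ i, W i : ℤ) : ℝ) = f p' + c * ((∑ i, w i : ℤ) : ℝ) := by
    have h1 : (toE w : E d) = (p' : E d) + ((∑ i, w i : ℤ) : ℝ) • (y : E d) := by
      rw [← hprojw, coe_proj, h_toE]; abel
    rw [← h_toE, ← hMw, ← toEuclideanLin_iterMat_toE, h1, map_add, map_add, map_smul, hy, map_smul,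
      map_smul, v.2.2]
    simp [hf, mul_comm]
  have hW_le : ((∑ i, W i : ℤ) : ℝ) ≤ H := by
    have h1 : ((∑ i, w i : ℤ) : ℝ) < 0 := by exact_mod_cast hneg
    have h2 := hfH p' hp'
    have h3 : c * ((∑ i, w i : ℤ) : ℝ) < 0 := mul_neg_of_pos_of_neg hc h1
    linarith
  rw [hsumW] at hW_le
  push_cast at hW_le
  have hle : ((i' : ℕ) : ℝ) ≤ (comp s n).pos (u n) i' := by
    exact_mod_cast (comp s n).le_pos (u n) i'
  refine Nat.le_floor ?_
  have : (0 : ℝ) ≤ j' := Nat.cast_nonneg _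
  linarith

lemma nontrivial_P (hd : 1 ≤ d) : Nontrivial (P d) := by
  have : Nonempty (Fin d) := ⟨⟨0, hd⟩⟩
  exact (coordsP d).toEquiv.nontrivial

/-- The core is open and any other tile is the closure of a set meeting the core in finitely many
points; so the tile itself meets the core in those points only. They are negligible since `P` has
positive dimension, and there are countably many tiles. -/
lemma volume_core_diff_simpleSet (hd : 1 ≤ d)
    (hs : ∀ k, (s k).IsUnimodular) (hc : 0 < c)
    (hy : Matrix.toEuclideanLin (iterMat s n) (y : E d) = c • (v : E d))
    (hirr : TotallyIrrational y) {p : P d}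
    {b : Fin (d + 1)} (hp : ∀ z : Fin (d + 1) → ℤ, 0 ≤ ∑ i, z i →
      norm1 ((proj y (toE z) : E d) - (p : E d)) < r → z ∈ wormPiece (u n) b)
    {j : ℕ} (hj : j < ((comp s n).img b).length) :
    volume ({x | x - j • trans v ∈ restrictMat s v n '' ball1 p r} \ simpleSet s v u n) = 0 := by
  have := nontrivial_P hd
  set O := {x | x - j • trans v ∈ restrictMat s v n '' ball1 p r} with hO
  have hOopen : IsOpen O :=
    (isOpen_image_restrictMat hs hy (isOpen_ball1 p r)).preimage
      (f := fun x : P d => x - j • trans v) (by fun_prop)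
  have hsub : O \ simpleSet s v u n ⊆ ⋃ τ : Fin (d + 1) × ℕ × Lam d,
      ⋃ _ : τ ≠ (b, j, 0), O ∩ {x | τ ∈ hits s v u n x} := by
    rintro x ⟨hxO, hx⟩
    have h1 : (b, j, (0 : Lam d)) ∈ hits s v u n x :=
      ⟨hj, by simpa using image_ball1_subset_piece hirr hy hp hxO⟩
    by_contra hcon
    simp only [mem_iUnion, not_exists, mem_inter_iff, hxO, true_and] at hcon
    refine hx fun τ hτ τ' hτ' => ?_
    have h2 : ∀ τ ∈ hits s v u n x, τ = (b, j, 0) := fun τ hτ => by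
      by_contra hne
      exact hcon τ hne hτ
    rw [h2 τ hτ, h2 τ' hτ']
  refine measure_mono_null hsub ?_
  rw [measure_iUnion_null_iff]
  rintro ⟨b', j', g'⟩
  rw [measure_iUnion_null_iff]
  intro hne
  by_cases hj' : j' < ((comp s n).img b').length
  swap
  · refine measure_mono_null (t := ∅) ?_ measure_empty
    rintro x ⟨-, hx⟩
    exact hj' hx.1
  have hfin := finite_core_inter hs hc hy hp hj hj' hne
  rw [← hO] at hfin
  refine measure_mono_null ?_ (hfin.measure_zero volume)
  rw [← hfin.isClosed.closure_eq]
  rintro x ⟨hxO, -, hx⟩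
  refine hOopen.inter_closure ⟨hxO, ?_⟩
  have h1 := (Homeomorph.subRight (j' • trans v + (g' : P d))).preimage_closure
    ((fun z => projMat s v n (toE z)) '' wormPiece (u n) b')
  simp only [Homeomorph.coe_subRight] at h1
  simp only [sub_sub] at hx ⊢
  change x ∈ closure ((fun x : P d => x - (j' • trans v + (g' : P d))) ⁻¹' _)
  rw [← h1]
  exact hx

/-- The set of simple points modulo the lattice has measure at least that of a ball. -/
theorem volume_ball1_le_simpleSet (hd : 1 ≤ d)
    (hs : ∀ k, (s k).IsUnimodular) (hv : TotallyIrrational v) (hn : HasBalls s v u r n) :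
    volume (ball1 (0 : P d) r) ≤ volume (simpleSet s v u n ∩ unitBox d) := by
  obtain ⟨y, c, hc, hy, hballs⟩ := hn
  have hirr := hv.of_direction hs hc hy
  choose p hp using hballs
  set L := restrictMat s v n with hL
  let ι := (Σ b : Fin (d + 1), Fin ((comp s n).img b).length)
  let core : ι → Set (P d) := fun i => {x | x - (i.2 : ℕ) • trans v ∈ L '' ball1 (p i.1) r}
  let V : ι → Set (P d) := fun i => core i ∩ simpleSet s v u n
  have hball : ∀ p : P d, volume (ball1 p r) = volume (ball1 (0 : P d) r) := by
    intro p
    have : ball1 (0 : P d) r = (fun x => x + p) ⁻¹' ball1 p r := by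
      ext x; simp [ball1]
    rw [this, measure_preimage_add_right]
  have hcoremeas : ∀ i, MeasurableSet (core i) := fun i =>
    ((isOpen_image_restrictMat hs hy (isOpen_ball1 _ r)).preimage
      (f := fun x : P d => x - (i.2 : ℕ) • trans v) (by fun_prop)).measurableSet
  have hVmeas : ∀ i, MeasurableSet (V i) := fun i =>
    (hcoremeas i).inter (measurableSet_simpleSet n)
  have hVvol : ∀ i, volume (V i) =
      ENNReal.ofReal |LinearMap.det L| * volume (ball1 (0 : P d) r) := by
    intro i
    have h1 : volume (V i) = volume (core i) := by
      have h2 := volume_core_diff_simpleSet hd hs hc hy hirr (hp i.1) i.2.2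
      have h3 := measure_inter_add_sdiff (μ := volume) (core i)
        (measurableSet_simpleSet (s := s) (v := v) (u := u) n)
      rw [← h3, h2, add_zero]
    have h4 : core i = (fun x => x + (-((i.2 : ℕ) • trans v))) ⁻¹' (L '' ball1 (p i.1) r) := by
      ext x; simp [core, sub_eq_add_neg]
    rw [h1, h4, measure_preimage_add_right, Measure.addHaar_image_linearMap, hball]
  have hVhits : ∀ i x, x ∈ core i → (i.1, (i.2 : ℕ), (0 : Lam d)) ∈ hits s v u n x :=
    fun i x hx => ⟨i.2.2, by simpa using image_ball1_subset_piece hirr hy (hp i.1) hx⟩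
  have hmem : ∀ (i : ι) (g : Lam d) (x : P d), x ∈ g +ᵥ V i →
      x ∈ simpleSet s v u n ∧ (i.1, (i.2 : ℕ), g) ∈ hits s v u n x := by
    rintro i g _ ⟨x, ⟨hx1, hx2⟩, rfl⟩
    refine ⟨(add_Lam_mem_simpleSet g).mpr hx2, ?_⟩
    change _ ∈ hits s v u n ((g : P d) + x)
    rw [mem_hits_add_Lam, sub_self]
    exact hVhits i x hx1
  let Z : ι × Lam d → Set (P d) := fun k => (k.2 +ᵥ V k.1) ∩ unitBox d
  -- At a simple point the index `(b, j, g)` of the tile is unique.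
  have hZdisj : Pairwise (Function.onFun Disjoint Z) := by
    rintro ⟨⟨b, j⟩, g⟩ ⟨⟨b', j'⟩, g'⟩ hne
    refine Set.disjoint_left.mpr fun x hx hx' => hne ?_
    obtain ⟨h1, h2⟩ := hmem _ _ _ hx.1
    obtain ⟨-, h3⟩ := hmem _ _ _ hx'.1
    have h4 := h1 h2 h3
    simp only [Prod.mk.injEq] at h4
    obtain ⟨rfl, h5, rfl⟩ := h4
    obtain rfl := Fin.ext h5
    rfl
  have hZmeas : ∀ k, MeasurableSet (Z k) := fun k =>
    ((hVmeas k.1).const_vadd k.2).inter measurableSet_unitBox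
  calc volume (ball1 (0 : P d) r)
      ≤ ENNReal.ofReal (∑ b, ((comp s n).img b).length * |LinearMap.det L|) *
          volume (ball1 (0 : P d) r) := by
        refine le_mul_of_one_le_left zero_le ?_
        rw [← ENNReal.ofReal_one]
        exact ENNReal.ofReal_le_ofReal (one_le_sum_length_mul_abs_det hs hc hy)
    _ = ∑ i : ι, volume (V i) := by
        simp only [hVvol, Finset.sum_const, Finset.card_univ, nsmul_eq_mul, ← mul_assoc]
        congr 1
        rw [← Finset.sum_mul, ENNReal.ofReal_mul (by positivity)]
        congr 1
        rw [Fintype.card_sigma]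
        simp only [Fintype.card_fin]
        rw [← Nat.cast_sum, ENNReal.ofReal_natCast]
    _ = ∑' i : ι, ∑' g : Lam d, volume (Z (i, g)) := by
        rw [tsum_fintype]
        exact Finset.sum_congr rfl fun i _ =>
          isAddFundamentalDomain_unitBox.measure_eq_tsum (V i)
    _ = volume (⋃ k, Z k) := by
        rw [measure_iUnion hZdisj hZmeas, ENNReal.tsum_prod']
    _ ≤ _ := by
        refine measure_mono (iUnion_subset fun k => ?_)
        rintro x ⟨hx1, hx2⟩
        exact ⟨(hmem _ _ _ hx1).1, hx2⟩

end

end SAdic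

namespace SAdic

open scoped Pointwise

noncomputable section

variable {d : ℕ} {s : ℕ → Substitution d} {v : Simplex d} {n : ℕ} {r : ℝ}
  {u : ℕ → ℕ → Fin (d + 1)} {K ρ : ℝ}

/-! ### Ergodicity -/

/-- A totally irrational translation of the torus is ergodic. -/
theorem ergodic_add_trans (hv : TotallyIrrational v) :
    Ergodic (fun z => z + q d (trans v)) (torusMeasure d) := by
  have hinv : (torusMeasure d).IsAddLeftInvariant := ⟨fun z => by
    simpa only [add_comm z] using (measurePreserving_add_right z).map_eq⟩
  have h1 : DenseRange fun n : ℕ => n • q d (trans v) := by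
    simpa [DenseRange] using dense_orbit hv 0
  have h2 := ergodic_vadd_of_denseRange_nsmul h1 (torusMeasure d)
  simpa only [vadd_eq_add, add_comm] using h2

lemma ae_torus_of_ae {p : Torus d → Prop} (hp : MeasurableSet {z | p z})
    (h : ∀ᵐ x ∂(volume : Measure (P d)), p (q d x)) : ∀ᵐ z ∂torusMeasure d, p z :=
  torusMeasure_eq_zero hp.compl h

lemma ae_of_ae_torus {p : Torus d → Prop} (hp : MeasurableSet {z | p z})
    (h : ∀ᵐ z ∂torusMeasure d, p z) : ∀ᵐ x ∂(volume : Measure (P d)), p (q d x) := by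
  refine isAddFundamentalDomain_unitBox.measure_zero_of_invariant
    (q d ⁻¹' {z | p z}ᶜ) (fun g => ?_) ?_
  · ext x
    rw [mem_vadd_set_iff_neg_vadd_mem]
    simp only [mem_preimage]
    have h1 : q d (-g +ᵥ x) = q d x := by rw [q_eq_q_iff]; simp
    rw [h1]
  · rw [← torusMeasure_apply hp.compl]
    exact h

lemma volume_saturation_inter_unitBox_le (Y : Set (P d)) :
    volume ({x | ∃ g : Lam d, x - (g : P d) ∈ Y} ∩ unitBox d) ≤ volume Y := by
  rw [isAddFundamentalDomain_unitBox.measure_eq_tsum Y]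
  have h1 : {x | ∃ g : Lam d, x - (g : P d) ∈ Y} ∩ unitBox d ⊆
      ⋃ g : Lam d, (g +ᵥ Y) ∩ unitBox d := by
    rintro x ⟨⟨g, hg⟩, hx⟩
    refine mem_iUnion.mpr ⟨g, ?_, hx⟩
    rw [mem_vadd_set_iff_neg_vadd_mem, Lam_vadd_apply]
    simpa [sub_eq_add_neg, add_comm] using hg
  exact (measure_mono h1).trans (measure_iUnion_le _)

/-! ### Almost every point is simple at all levels -/

variable (s v u) in
/-- The points at which the translation by `e_0 - v` leaves a tower of level `n`, or enters one. -/
def transitionSet (n : ℕ) : Set (P d) :=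
  {x | ∃ b, ∃ g : Lam d, x - (g : P d) ∈ (fun x => x + trans v) ⁻¹' piece s v u n b} ∪
  {x | ∃ b, ∃ g : Lam d, x - (g : P d) ∈
    (fun x => x + (trans v - ((comp s n).img b).length • trans v)) ⁻¹' piece s v u n b}

/-- The translation carries floor `j` of a tower to floor `j + 1`. Unless `x` is in a top floor or
`x + t` in a base, this is a bijection between the tiles containing `x` and those containing `x +
t`. -/
lemma add_trans_mem_simpleSet {x : P d} (hx : x ∉ transitionSet s v u n) :
    x + trans v ∈ simpleSet s v u n ↔ x ∈ simpleSet s v u n := by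
  simp only [transitionSet, mem_union, mem_ofPred_eq, mem_preimage, not_or, not_exists] at hx
  obtain ⟨hbase, htop⟩ := hx
  have h0 : ∀ b (g : Lam d), (b, 0, g) ∉ hits s v u n (x + trans v) := by
    rintro b g ⟨-, h⟩
    refine hbase b g ?_
    convert h using 1
    simp only [zero_smul]
    abel
  have hsucc : ∀ b j (g : Lam d), (b, j + 1, g) ∈ hits s v u n (x + trans v) ↔
      (b, j, g) ∈ hits s v u n x := by
    intro b j g
    have h1 : x + trans v - (j + 1) • trans v - (g : P d) = x - j • trans v - (g : P d) := by
      rw [add_smul, one_smul]; abel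
    simp only [hits, mem_ofPred_eq, h1]
    refine and_congr_left fun h => ⟨fun h2 => by omega, fun h2 => ?_⟩
    rcases Nat.lt_or_ge (j + 1) ((comp s n).img b).length with h3 | h3
    · exact h3
    · exfalso
      refine htop b g ?_
      have h4 : ((comp s n).img b).length = j + 1 := by omega
      rw [h4, add_smul, one_smul]
      convert h using 1
      abel
  constructor
  · rintro h ⟨b, j, g⟩ hτ ⟨b', j', g'⟩ hτ'
    have := h ((hsucc _ _ _).mpr hτ) ((hsucc _ _ _).mpr hτ')
    simpa using this
  · rintro h ⟨b, j, g⟩ hτ ⟨b', j', g'⟩ hτ'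
    rcases j with _ | j
    · exact absurd hτ (h0 _ _)
    rcases j' with _ | j'
    · exact absurd hτ' (h0 _ _)
    simpa using h ((hsucc _ _ _).mp hτ) ((hsucc _ _ _).mp hτ')

lemma volume_transitionSet_inter_unitBox_le (hK : PieceBound s v K ρ) (hu : IsFixedPoint s u)
    (n : ℕ) : volume (transitionSet s v u n ∩ unitBox d) ≤
      2 * (d + 1) * volume (Metric.closedBall (0 : P d) (K * ρ ^ n)) := by
  have h1 : ∀ (w : Fin (d + 1) → P d), volume ({x | ∃ b, ∃ g : Lam d, x - (g : P d) ∈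
      (fun x => x + w b) ⁻¹' piece s v u n b} ∩ unitBox d) ≤
        (d + 1) * volume (Metric.closedBall (0 : P d) (K * ρ ^ n)) := by
    intro w
    calc _ ≤ volume (⋃ b, {x | ∃ g : Lam d, x - (g : P d) ∈
          (fun x => x + w b) ⁻¹' piece s v u n b} ∩ unitBox d) := by
          refine measure_mono ?_
          rintro x ⟨⟨b, hb⟩, hx⟩
          exact mem_iUnion.mpr ⟨b, hb, hx⟩
      _ ≤ ∑ b, volume ({x | ∃ g : Lam d, x - (g : P d) ∈
          (fun x => x + w b) ⁻¹' piece s v u n b} ∩ unitBox d) := measure_iUnion_fintype_le _ _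
      _ ≤ ∑ _b : Fin (d + 1), volume (Metric.closedBall (0 : P d) (K * ρ ^ n)) := by
          refine Finset.sum_le_sum fun b _ => (volume_saturation_inter_unitBox_le _).trans ?_
          rw [measure_preimage_add_right]
          exact measure_mono (hK.2.2.2 u hu n b)
      _ = _ := by simp
  rw [transitionSet, union_inter_distrib_right]
  refine (measure_union_le _ _).trans ((add_le_add (h1 fun _ => _) (h1 fun b => _)).trans ?_)
  rw [mul_assoc, two_mul]

lemma tendsto_volume_closedBall (hd : 1 ≤ d) (hK0 : 0 < K) (hρ : 0 < ρ) (hρ1 : ρ < 1) :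
    Tendsto (fun n : ℕ => volume (Metric.closedBall (0 : P d) (K * ρ ^ n))) atTop (𝓝 0) := by
  have := nontrivial_P hd
  have h1 : Tendsto (fun n : ℕ => K * ρ ^ n) atTop (𝓝 0) := by
    simpa using (tendsto_pow_atTop_nhds_zero_of_lt_one hρ.le hρ1).const_mul K
  have h2 : ⋂ n : ℕ, Metric.closedBall (0 : P d) (K * ρ ^ n) = {0} := by
    ext x
    simp only [mem_iInter, mem_closedBall_zero_iff, mem_singleton_iff]
    constructor
    · intro hx
      exact norm_le_zero_iff.mp (ge_of_tendsto' h1 hx)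
    · rintro rfl n
      simpa using by positivity
  have h3 := tendsto_measure_iInter_atTop (μ := (volume : Measure (P d)))
    (s := fun n : ℕ => Metric.closedBall (0 : P d) (K * ρ ^ n))
    (fun n => Metric.isClosed_closedBall.measurableSet.nullMeasurableSet) (fun m n hmn => by
      refine Metric.closedBall_subset_closedBall ?_
      have := pow_le_pow_of_le_one hρ.le hρ1.le hmn
      gcongr) ⟨0, (isCompact_closedBall _ _).measure_lt_top.ne⟩
  rwa [h2, measure_singleton] at h3

/-- The measures of the transition sets modulo `Λ` tend to `0`, so the points belonging to all of
them from some rank on form a null set. -/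
lemma ae_frequently_notMem_transitionSet (hd : 1 ≤ d) (hK : PieceBound s v K ρ)
    (hu : IsFixedPoint s u) :
    ∀ᵐ x ∂(volume : Measure (P d)), ∃ᶠ n in atTop, x ∉ transitionSet s v u n := by
  have hinv : ∀ (g : Lam d) x n, (g : P d) + x ∈ transitionSet s v u n ↔
      x ∈ transitionSet s v u n := by
    intro g x n
    have h1 : ∀ Y : Fin (d + 1) → Set (P d),
        (∃ b, ∃ g' : Lam d, (g : P d) + x - (g' : P d) ∈ Y b) ↔
          ∃ b, ∃ g' : Lam d, x - (g' : P d) ∈ Y b := by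
      intro Y
      refine exists_congr fun b => ⟨fun ⟨g', h⟩ => ⟨g' - g, ?_⟩, fun ⟨g', h⟩ => ⟨g' + g, ?_⟩⟩
      · convert h using 1
        rw [AddSubgroup.coe_sub]; abel
      · convert h using 1
        rw [AddSubgroup.coe_add]; abel
    simp only [transitionSet, mem_union, mem_ofPred_eq]
    exact or_congr (h1 _) (h1 _)
  have hlim : Tendsto (fun n => volume (transitionSet s v u n ∩ unitBox d)) atTop (𝓝 0) := by
    have h1 := ENNReal.Tendsto.const_mul (a := 2 * ((d : ENNReal) + 1))
      (tendsto_volume_closedBall hd hK.1 hK.2.1 hK.2.2.1) (Or.inr (by finiteness))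
    rw [mul_zero] at h1
    exact tendsto_of_tendsto_of_tendsto_of_le_of_le tendsto_const_nhds h1
      (fun _ => zero_le) (volume_transitionSet_inter_unitBox_le hK hu)
  have hnull : ∀ m : ℕ, volume (⋂ n ≥ m, transitionSet s v u n) = 0 := by
    intro m
    refine isAddFundamentalDomain_unitBox.measure_zero_of_invariant _ (fun g => ?_) ?_
    · ext x
      rw [mem_vadd_set_iff_neg_vadd_mem, Lam_vadd_apply]
      simp only [mem_iInter, hinv]
    · refine le_antisymm (ge_of_tendsto hlim ?_) zero_le
      filter_upwards [eventually_ge_atTop m] with n hn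
      exact measure_mono (inter_subset_inter_left _ (iInter₂_subset n hn))
  have h2 : ∀ᵐ x ∂(volume : Measure (P d)), ∀ m : ℕ, x ∉ ⋂ n ≥ m, transitionSet s v u n :=
    ae_all_iff.mpr fun m => measure_eq_zero_iff_ae_notMem.mp (hnull m)
  filter_upwards [h2] with x hx
  rw [frequently_atTop]
  intro m
  have := hx m
  simp only [mem_iInter, not_forall] at this
  obtain ⟨n, hn, hxn⟩ := this
  exact ⟨n, hn, hxn⟩

/-- Almost every point belongs to at most one tile of level `0`. -/
theorem ae_mem_simpleSet_zero (hd : 1 ≤ d) (hs : ∀ k, (s k).IsUnimodular)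
    (hv : TotallyIrrational v) (hK : PieceBound s v K ρ) (hu : IsFixedPoint s u) (hr : 0 < r)
    (hballs : ∃ᶠ n in atTop, HasBalls s v u r n) :
    ∀ᵐ x ∂(volume : Measure (P d)), x ∈ simpleSet s v u 0 := by
  set I := ⋂ n, simpleSet s v u n with hI
  have hImeas : MeasurableSet I := MeasurableSet.iInter fun n => measurableSet_simpleSet n
  have hIinv : ∀ (g : Lam d) x, (g : P d) + x ∈ I ↔ x ∈ I := fun g x => by
    simp only [hI, mem_iInter, add_Lam_mem_simpleSet]
  set J := q d '' I with hJ
  have hqJ : q d ⁻¹' J = I := by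
    ext x
    constructor
    · rintro ⟨x', hx', hxx'⟩
      have h1 := q_eq_q_iff.mp hxx'.symm
      rw [← hIinv ⟨_, h1⟩] at hx'
      simpa using hx'
    · exact fun hx => ⟨x, hx, rfl⟩
  have hJmeas : MeasurableSet J := by
    rw [← hqJ] at hImeas
    exact measurableSet_quotient.mpr hImeas
  have hpos : torusMeasure d J ≠ 0 := by
    rw [torusMeasure_apply hJmeas, hqJ]
    have h1 : volume (ball1 (0 : P d) r) ≠ 0 :=
      ((isOpen_ball1 0 r).measure_pos _ ⟨0, mem_ball1_self 0 hr⟩).ne'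
    have hfin : IsFiniteMeasure ((volume : Measure (P d)).restrict (unitBox d)) :=
      ⟨by simpa using volume_unitBox_lt_top⟩
    -- Continuity from above: each simple set contains a later one at a level with balls, so the
    -- measure never drops below that of a ball.
    have h2 := tendsto_measure_iInter_atTop (μ := (volume : Measure (P d)).restrict (unitBox d))
      (s := simpleSet s v u) (fun n => (measurableSet_simpleSet n).nullMeasurableSet)
      (simpleSet_antitone hu) ⟨0, measure_ne_top _ _⟩
    rw [Measure.restrict_apply hImeas] at h2
    refine ne_bot_of_le_ne_bot h1 (ge_of_tendsto' h2 fun n => ?_)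
    obtain ⟨m, hm, hbm⟩ := (frequently_atTop.mp hballs) n
    simp only [Function.comp_apply]
    rw [Measure.restrict_apply (measurableSet_simpleSet n)]
    exact (volume_ball1_le_simpleSet hd hs hv hbm).trans
      (measure_mono (inter_subset_inter_left _ (simpleSet_antitone hu hm)))
  have hmp := measurePreserving_add_right (q d (trans v))
  have hshift : (fun z => z + q d (trans v)) ⁻¹' J =ᵐ[torusMeasure d] J := by
    have h1 : ∀ᵐ z ∂torusMeasure d, z ∈ (fun z => z + q d (trans v)) ⁻¹' J ↔ z ∈ J := by
      refine ae_torus_of_ae ?_ ?_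
      · exact MeasurableSet.iff (hmp.measurable hJmeas) hJmeas
      · filter_upwards [ae_frequently_notMem_transitionSet hd hK hu] with x hx
        have h2 : ∀ y : P d, q d y ∈ J ↔ y ∈ I := fun y => by rw [← hqJ]; rfl
        rw [mem_preimage, ← q_add, h2, h2]
        -- The simple sets decrease, so simplicity at infinitely many levels is simplicity at all
        -- levels.
        have h3 : ∀ y, (∀ n, x ∉ transitionSet s v u n → y ∈ simpleSet s v u n) → y ∈ I := by
          intro y hy
          refine mem_iInter.mpr fun n => ?_
          obtain ⟨m, hm, hxm⟩ := (frequently_atTop.mp hx) n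
          exact simpleSet_antitone hu hm (hy m hxm)
        exact ⟨fun h => h3 _ fun n hn => (add_trans_mem_simpleSet hn).mp (mem_iInter.mp h n),
          fun h => h3 _ fun n hn => (add_trans_mem_simpleSet hn).mpr (mem_iInter.mp h n)⟩
    filter_upwards [h1] with z hz
    exact propext hz
  have hfull : ∀ᵐ z ∂torusMeasure d, z ∈ J := by
    rcases (ergodic_add_trans hv).quasiErgodic.ae_mem_or_ae_notMem₀ hJmeas.nullMeasurableSet
      hshift with h1 | h1
    · exact h1
    · exact absurd (measure_eq_zero_iff_ae_notMem.mpr h1) hpos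
  filter_upwards [ae_of_ae_torus hJmeas hfull] with x hx
  have h1 : x ∈ q d ⁻¹' J := hx
  rw [hqJ] at h1
  exact mem_iInter.mp h1 0

end

end SAdic

namespace SAdic

open scoped Pointwise

noncomputable section

variable {d : ℕ}

/-! ### Codings -/

lemma add_right_iterate (t z : Torus d) (n : ℕ) : (fun z => z + t)^[n] z = z + n • t := by
  simp

lemma shift_coding {X I : Type*} [Nonempty I] (T : X → X) (Q : I → Set X) (z : X) (n : ℕ) :
    coding T Q (T z) n = coding T Q z (n + 1) := by
  simp only [coding, Function.iterate_succ_apply]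

/-- The `n`-th letter depends only on which atoms contain `T^[n] z`, that is, on a point of the
countable space `I → Prop`; so the arbitrary choice is harmless. -/
lemma measurable_coding {X I : Type*} [Nonempty I] [Finite I] [MeasurableSpace X]
    [MeasurableSpace I] {T : X → X} (hT : Measurable T) {Q : I → Set X}
    (hQ : ∀ i, MeasurableSet (Q i)) : Measurable (coding T Q) := by
  refine measurable_pi_lambda _ fun n => ?_
  have h1 : Measurable fun z : X => (fun i => T^[n] z ∈ Q i : I → Prop) :=
    measurable_pi_lambda _ fun i => measurableSet_setOfPred.mp ((hT.iterate n) (hQ i))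
  exact (measurable_of_countable (fun p : I → Prop => Classical.epsilon p)).comp h1

/-! ### Exchanges of pieces -/

/-- The points of the torus that have at most one lift, in at most one of the sets `R a`. -/
def singleSet (R : Fin (d + 1) → Set (P d)) : Set (Torus d) :=
  {z | ∀ a a' x x', x ∈ R a → x' ∈ R a' → q d x = z → q d x' = z → a = a' ∧ x = x'}

/-- A covering of the torus by regular compact pieces of `P`, disjoint in measure, the union of
which is preserved by the translation of each piece by the projection of a basis vector. -/
structure IsPieceExchange (v : Simplex d) (R : Fin (d + 1) → Set (P d)) : Prop where
  irrational : TotallyIrrational v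
  isCompact : ∀ a, IsCompact (R a)
  closure_interior : ∀ a, R a = closure (interior (R a))
  exchange : ∀ a, ∀ x ∈ R a, ∃ b, x + proj v (e a) ∈ R b
  cover : ∀ z, ∃ a, z ∈ q d '' R a
  measurableSet_single : MeasurableSet (singleSet R)
  ae_single : ∀ᵐ z ∂torusMeasure d, z ∈ singleSet R

lemma toE_single (a : Fin (d + 1)) : (toE (Pi.single a 1) : E d) = e a := by
  ext i
  by_cases hi : i = a
  · subst hi; simp [e]
  · simp [e, hi]

lemma q_proj_e (v : Simplex d) (a : Fin (d + 1)) : q d (proj v (e a)) = q d (trans v) := by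
  rw [q_eq_q_iff]
  have := proj_toE_sub_mem_Lam v (Pi.single a 1)
  simpa [toE_single] using this

/-! ### Fundamental domain, regularity and liftability -/

namespace IsPieceExchange

variable {v : Simplex d} {R : Fin (d + 1) → Set (P d)} (hR : IsPieceExchange v R)

include hR

lemma isClosed_piece (a : Fin (d + 1)) : IsClosed (R a) := (hR.isCompact a).isClosed

lemma isClosed_atom (a : Fin (d + 1)) : IsClosed (q d '' R a) :=
  ((hR.isCompact a).image continuous_q).isClosed

lemma isCompact_iUnion : IsCompact (⋃ a, R a) := _root_.isCompact_iUnion hR.isCompact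

lemma ae_mem_single : ∀ᵐ x ∂(volume : Measure (P d)), q d x ∈ singleSet R :=
  ae_of_ae_torus hR.measurableSet_single hR.ae_single

lemma volume_inter_eq_zero {a b : Fin (d + 1)} (hab : a ≠ b) : volume (R a ∩ R b) = 0 := by
  refine measure_mono_null ?_ (ae_iff.mp hR.ae_mem_single)
  rintro x ⟨ha, hb⟩ hx
  exact hab (hx a b x x ha hb rfl rfl).1

lemma isAddFundamentalDomain :
    IsAddFundamentalDomain (Lam d) (⋃ a, R a) (volume : Measure (P d)) where
  nullMeasurableSet := hR.isCompact_iUnion.measurableSet.nullMeasurableSet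
  ae_covers := Eventually.of_forall fun x => by
    obtain ⟨a, y, hy, hyx⟩ := hR.cover (q d x)
    refine ⟨⟨y - x, q_eq_q_iff.mp hyx⟩, mem_iUnion.mpr ⟨a, ?_⟩⟩
    simpa using hy
  aedisjoint := by
    intro g g' hgg'
    refine measure_mono_null ?_ (ae_iff.mp hR.ae_mem_single)
    rintro x ⟨hx, hx'⟩ hxs
    rw [mem_vadd_set_iff_neg_vadd_mem, mem_iUnion] at hx hx'
    obtain ⟨a, ha⟩ := hx
    obtain ⟨a', ha'⟩ := hx'
    have hq : ∀ g : Lam d, q d (-g +ᵥ x) = q d x := fun g => by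
      rw [q_eq_q_iff]; simp
    have h1 := (hxs a a' _ _ ha ha' (hq g) (hq g')).2
    simp only [Lam_vadd_apply, add_left_inj, SetLike.coe_eq_coe, neg_inj] at h1
    exact hgg' h1

lemma isMeasurablePartition :
    IsMeasurablePartition (torusMeasure d) univ fun a => q d '' R a where
  measurableSet a := (hR.isClosed_atom a).measurableSet
  aedisjoint := by
    intro a b hab
    refine measure_mono_null ?_ (ae_iff.mp hR.ae_single)
    rintro z ⟨⟨x, hx, rfl⟩, ⟨y, hy, hyx⟩⟩ hz
    exact hab (hz a b x y hx hy rfl hyx).1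
  iUnion_eq := by
    have : ⋃ a, q d '' R a = univ := eq_univ_of_forall fun z => mem_iUnion.mpr (hR.cover z)
    rw [this]
    exact ae_eq_refl _

/-- The other atoms are closed and cover the complement of a given atom. A boundary point thus lies
in two atoms, which almost never happens. -/
lemma isRegular : IsRegular (torusMeasure d) fun a => q d '' R a := by
  intro a
  constructor
  · refine Subset.antisymm ?_ (closure_mono interior_subset)
    rw [(hR.isClosed_atom a).closure_eq]
    conv_lhs => rw [hR.closure_interior a]
    refine (image_closure_subset_closure_image continuous_q).trans (closure_mono ?_)
    exact interior_maximal (image_mono interior_subset) (isOpenMap_q _ isOpen_interior)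
  · refine measure_mono_null ?_ (ae_iff.mp hR.ae_single)
    intro z hz hzs
    have h1 : z ∈ q d '' R a := (hR.isClosed_atom a).frontier_subset hz
    have hcl : IsClosed (⋃ b : {b // b ≠ a}, q d '' R b) :=
      isClosed_iUnion_of_finite fun b => hR.isClosed_atom b
    have hsub : (q d '' R a)ᶜ ⊆ ⋃ b : {b // b ≠ a}, q d '' R b := by
      intro z' hz'
      obtain ⟨b, hb⟩ := hR.cover z'
      exact mem_iUnion.mpr ⟨⟨b, fun hba => hz' (hba ▸ hb)⟩, hb⟩
    have h2 := closure_minimal hsub hcl (frontier_eq_closure_inter_closure.subset hz).2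
    obtain ⟨⟨b, hba⟩, hb⟩ := mem_iUnion.mp h2
    obtain ⟨x, hx, rfl⟩ := h1
    obtain ⟨y, hy, hyx⟩ := hb
    exact hba (hzs a b x y hx hy rfl hyx).1.symm

lemma isLiftable : IsLiftable (q d (trans v)) fun a => q d '' R a := by
  refine ⟨⋃ a, R a, R, fun a => proj v (e a), hR.isCompact_iUnion.measurableSet,
    hR.isAddFundamentalDomain, ⟨fun a => (hR.isClosed_piece a).measurableSet,
      fun a b hab => hR.volume_inter_eq_zero hab, ae_eq_refl _⟩, fun a => ⟨subset_iUnion R a,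
      fun y hy => ?_, rfl, q_proj_e v a⟩⟩
  obtain ⟨b, hb⟩ := hR.exchange a y hy
  exact mem_iUnion.mpr ⟨b, hb⟩

end IsPieceExchange

/-- The points whose forward orbit under the translation by `e_0 - v` stays in `singleSet R`. -/
def regularSet (v : Simplex d) (R : Fin (d + 1) → Set (P d)) : Set (Torus d) :=
  {z | ∀ n : ℕ, z + n • q d (trans v) ∈ singleSet R}

/-- The coding of the translation by `e_0 - v`. -/
abbrev pieceCoding (v : Simplex d) (R : Fin (d + 1) → Set (P d)) :
    Torus d → ℕ → Fin (d + 1) :=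
  coding (fun z => z + q d (trans v)) fun a => q d '' R a

/-! ### Generation, bounded remainders and symbolic conjugacy -/

namespace IsPieceExchange

variable {v : Simplex d} {R : Fin (d + 1) → Set (P d)} (hR : IsPieceExchange v R)

include hR

lemma measurableSet_regularSet : MeasurableSet (regularSet v R) := by
  have : regularSet v R = ⋂ n : ℕ, (fun z => z + n • q d (trans v)) ⁻¹' singleSet R := by
    ext z; simp [regularSet]
  rw [this]
  exact MeasurableSet.iInter fun n =>
    (measurePreserving_add_right _).measurable hR.measurableSet_single

lemma ae_mem_regularSet : ∀ᵐ z ∂torusMeasure d, z ∈ regularSet v R := by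
  refine ae_all_iff.mpr fun n => ?_
  exact (measurePreserving_add_right (n • q d (trans v))).quasiMeasurePreserving.ae hR.ae_single

omit hR in
lemma add_mem_regularSet {z : Torus d} (hz : z ∈ regularSet v R) :
    z + q d (trans v) ∈ regularSet v R := by
  intro n
  have := hz (n + 1)
  rwa [add_comm n 1, add_smul, one_smul, ← add_assoc] at this

lemma mem_atom_iff {z : Torus d} (hz : z ∈ regularSet v R) (n : ℕ) (a : Fin (d + 1)) :
    z + n • q d (trans v) ∈ q d '' R a ↔ pieceCoding v R z n = a := by
  have hspec : z + n • q d (trans v) ∈ q d '' R (pieceCoding v R z n) := by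
    have h1 : ∃ b, (fun z => z + q d (trans v))^[n] z ∈ q d '' R b := hR.cover _
    have h2 := Classical.epsilon_spec h1
    exact (add_right_iterate (q d (trans v)) z n) ▸ h2
  refine ⟨?_, fun h => h ▸ hspec⟩
  rintro ⟨x, hx, hxz⟩
  obtain ⟨y, hy, hyz⟩ := hspec
  exact (hz n _ _ y x hy hx hyz hxz).1

/-- The orbit of a regular point lifts to an orbit of the exchange of pieces. -/
lemma exists_lift {z : Torus d} (hz : z ∈ regularSet v R) :
    ∃ x : ℕ → P d, (∀ n, q d (x n) = z + n • q d (trans v)) ∧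
      (∀ n, x n ∈ R (pieceCoding v R z n)) ∧
      ∀ n, x n = x 0 + proj v (toE (ab (factor (pieceCoding v R z) 0 n))) := by
  have h1 : ∀ n, ∃ x ∈ R (pieceCoding v R z n), q d x = z + n • q d (trans v) := fun n =>
    (hR.mem_atom_iff hz n _).mpr rfl
  choose x hx hxz using h1
  refine ⟨x, hxz, hx, fun n => ?_⟩
  induction n with
  | zero => simp
  | succ n ih =>
    obtain ⟨b, hb⟩ := hR.exchange _ _ (hx n)
    have hqb : q d (x n + proj v (e (pieceCoding v R z n))) = z + (n + 1) • q d (trans v) := by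
      rw [q_add, q_proj_e, hxz, add_smul, one_smul, add_assoc]
    rw [(hz (n + 1) _ _ _ _ (hx (n + 1)) hb (hxz _) hqb).2, factor_succ, ab_append, toE_add,
      map_add, ab_singleton, toE_single, ← add_assoc, ← ih]

/-- With equal codings, the lifted orbits make the same jumps and differ by a constant `δ`. The
first one is dense in `R`, so `R + δ ⊆ R`; iterating in a bounded set forces `δ = 0`. -/
lemma injOn_pieceCoding : InjOn (pieceCoding v R) (regularSet v R) := by
  intro z hz z' hz' heq
  obtain ⟨x, hxz, hx, hxn⟩ := hR.exists_lift hz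
  obtain ⟨x', hxz', hx', hxn'⟩ := hR.exists_lift hz'
  set δ := x' 0 - x 0 with hδ
  have hδn : ∀ n, x n + δ = x' n := by
    intro n
    rw [hxn n, hxn' n, heq, hδ]
    abel
  have hdense : ⋃ a, R a ⊆ closure (range x) := by
    refine iUnion_subset fun a => ?_
    rw [hR.closure_interior a]
    refine closure_minimal (fun p hp => ?_) isClosed_closure
    rw [mem_closure_iff]
    intro O hO hpO
    have hop : IsOpen (q d '' (O ∩ interior (R a))) := isOpenMap_q _ (hO.inter isOpen_interior)
    obtain ⟨_, ⟨⟨p', ⟨hp'O, hp'R⟩, hp'⟩, n, rfl⟩⟩ :=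
      (dense_orbit hR.irrational z).inter_open_nonempty _ hop ⟨_, mem_image_of_mem _ ⟨hpO, hp⟩⟩
    -- The torus orbit enters the image of a small open part of `R a`, and uniqueness of lifts
    -- places `x n` in that very part.
    have h1 := (hz n _ _ _ _ (interior_subset hp'R) (hx n) hp' (hxz n)).2
    exact ⟨p', hp'O, n, h1.symm⟩
  have hstep : ∀ p ∈ ⋃ a, R a, p + δ ∈ ⋃ a, R a := by
    intro p hp
    have h1 : range x ⊆ (fun p => p + δ) ⁻¹' ⋃ a, R a := by
      rintro _ ⟨n, rfl⟩
      exact mem_iUnion.mpr ⟨_, (hδn n).symm ▸ hx' n⟩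
    exact closure_minimal h1 (hR.isCompact_iUnion.isClosed.preimage (by fun_prop)) (hdense hp)
  have hiter : ∀ n : ℕ, x 0 + n • δ ∈ ⋃ a, R a := by
    intro n
    induction n with
    | zero => simpa using ⟨_, hx 0⟩
    | succ n ih => rw [add_smul, one_smul, ← add_assoc]; exact hstep _ ih
  obtain ⟨D, hD⟩ := hR.isCompact_iUnion.isBounded.exists_norm_le
  have hδ0 : δ = 0 := by
    by_contra hne
    have hpos : 0 < ‖δ‖ := norm_pos_iff.mpr hne
    obtain ⟨n, hn⟩ := exists_nat_gt (2 * D / ‖δ‖)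
    rw [div_lt_iff₀ hpos] at hn
    have h1 := hD _ (hiter n)
    have h2 := hD _ (hiter 0)
    rw [zero_smul, add_zero] at h2
    have h3 : ‖n • δ‖ = n * ‖δ‖ := by rw [← Nat.cast_smul_eq_nsmul ℝ, norm_smul]; simp
    have h4 : ‖n • δ‖ ≤ ‖x 0 + n • δ‖ + ‖x 0‖ := by
      simpa using norm_sub_le (x 0 + n • δ) (x 0)
    linarith
  have h0 : x' 0 = x 0 := sub_eq_zero.mp hδ0
  have h1 := hxz 0
  have h2 := hxz' 0
  rw [zero_smul, add_zero] at h1 h2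
  rw [← h1, ← h2, h0]

lemma isGenerating : IsGenerating (torusMeasure d) (fun z => z + q d (trans v))
    fun a => q d '' R a :=
  ⟨hR.isMeasurablePartition, regularSet v R, ae_iff.mp hR.ae_mem_regularSet,
    hR.injOn_pieceCoding⟩

lemma sum_indicator_eq {z : Torus d} (hz : z ∈ regularSet v R) (a : Fin (d + 1)) (N : ℕ) :
    ∑ n ∈ Finset.range N, (q d '' R a).indicator (fun _ => (1 : ℝ))
      ((fun z => z + q d (trans v))^[n] z) = ab (factor (pieceCoding v R z) 0 N) a := by
  induction N with
  | zero => simp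
  | succ N ih =>
    rw [Finset.sum_range_succ, ih, factor_succ, ab_append, ab_singleton, Pi.add_apply,
      Int.cast_add, add_right_iterate]
    congr 1
    classical
    simp only [indicator_apply, hR.mem_atom_iff hz]
    by_cases h1 : pieceCoding v R z N = a
    · simp [h1]
    · simp [h1, Ne.symm h1]

/-- The discrepancy is the `a`-coordinate of `x N - x 0`, a difference of two points of the bounded
set `R`. -/
lemma exists_abs_sum_sub_le : ∃ D : ℝ, ∀ a, ∀ z ∈ regularSet v R, ∀ N : ℕ,
    |∑ n ∈ Finset.range N, (q d '' R a).indicator (fun _ => (1 : ℝ))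
      ((fun z => z + q d (trans v))^[n] z) - N * (v : E d) a| ≤ D := by
  obtain ⟨D, hD⟩ := hR.isCompact_iUnion.isBounded.exists_norm_le
  refine ⟨D + D, fun a z hz N => ?_⟩
  obtain ⟨x, -, hx, hxn⟩ := hR.exists_lift hz
  rw [hR.sum_indicator_eq hz]
  have h1 : ((x N - x 0 : P d) : E d) a =
      ab (factor (pieceCoding v R z) 0 N) a - N * (v : E d) a := by
    rw [hxn N, add_sub_cancel_left, coe_proj, h_toE_ab, length_factor]
    simp
  rw [← h1, ← Real.norm_eq_abs]
  refine (PiLp.norm_apply_le _ a).trans ?_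
  rw [← Submodule.coe_norm]
  exact (norm_sub_le _ _).trans (add_le_add (hD _ (mem_iUnion.mpr ⟨_, hx N⟩))
    (hD _ (mem_iUnion.mpr ⟨_, hx 0⟩)))

/-- Integrating the discrepancy over the torus gives an error `N |μ(Q_a) - v_a μ(univ)|` bounded in
`N`. -/
lemma measure_atom_eq (a : Fin (d + 1)) :
    (torusMeasure d (q d '' R a)).toReal = (v : E d) a * (torusMeasure d univ).toReal := by
  obtain ⟨D, hD⟩ := hR.exists_abs_sum_sub_le
  set μ := torusMeasure d
  set T : Torus d → Torus d := fun z => z + q d (trans v)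
  have hT : MeasurePreserving T μ μ := measurePreserving_add_right _
  have hQ := (hR.isClosed_atom a).measurableSet
  set f : Torus d → ℝ := (q d '' R a).indicator fun _ => (1 : ℝ)
  have hind : ∀ n : ℕ, (fun z => f (T^[n] z)) =
      ((T^[n]) ⁻¹' (q d '' R a)).indicator fun _ => (1 : ℝ) := fun n => by
    rfl
  have hmeas : ∀ n : ℕ, MeasurableSet ((T^[n]) ⁻¹' (q d '' R a)) := fun n =>
    (hT.iterate n).measurable hQ
  have hintg : ∀ n : ℕ, Integrable (fun z => f (T^[n] z)) μ := fun n => by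
    rw [hind]; exact (integrable_const 1).indicator (hmeas n)
  have hint : ∀ n : ℕ, ∫ z, f (T^[n] z) ∂μ = (μ (q d '' R a)).toReal := fun n => by
    rw [hind, integral_indicator (hmeas n), setIntegral_const, measureReal_def,
      (hT.iterate n).measure_preimage hQ.nullMeasurableSet]
    simp
  have key : ∀ N : ℕ, N * |(μ (q d '' R a)).toReal - (v : E d) a * (μ univ).toReal| ≤
      D * (μ univ).toReal := by
    intro N
    have h1 := norm_integral_le_of_norm_le_const (μ := μ) (C := D)
      (f := fun z => ∑ n ∈ Finset.range N, f (T^[n] z) - N * (v : E d) a)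
      (hR.ae_mem_regularSet.mono fun z hz => hD a z hz N)
    rw [integral_sub (integrable_finsetSum _ fun n _ => hintg n) (integrable_const _),
      integral_finsetSum _ fun n _ => hintg n] at h1
    simp only [hint, Finset.sum_const, Finset.card_range, nsmul_eq_mul, integral_const,
      measureReal_def, smul_eq_mul, Real.norm_eq_abs] at h1
    have h2 : (N : ℝ) * (μ (q d '' R a)).toReal - (μ univ).toReal * (N * (v : E d) a) =
        N * ((μ (q d '' R a)).toReal - (v : E d) a * (μ univ).toReal) := by ring
    rwa [h2, abs_mul, Nat.abs_cast] at h1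
  by_contra hne
  have hpos := abs_pos.mpr (sub_ne_zero.mpr hne)
  obtain ⟨N, hN⟩ := exists_nat_gt (D * (μ univ).toReal /
    |(μ (q d '' R a)).toReal - (v : E d) a * (μ univ).toReal|)
  rw [div_lt_iff₀ hpos] at hN
  exact absurd (key N) (not_le.mpr hN)

lemma isBoundedRemainder (a : Fin (d + 1)) :
    IsBoundedRemainder (torusMeasure d) (fun z => z + q d (trans v)) (q d '' R a) := by
  obtain ⟨D, hD⟩ := hR.exists_abs_sum_sub_le
  refine ⟨(hR.isClosed_atom a).measurableSet, D, hR.ae_mem_regularSet.mono fun z hz N => ?_⟩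
  have h0 : (torusMeasure d univ).toReal ≠ 0 :=
    (ENNReal.toReal_pos torusMeasure_univ_ne_zero (measure_ne_top _ _)).ne'
  rw [hR.measure_atom_eq, mul_div_assoc, div_self h0, mul_one]
  exact hD a z hz N

/-- The atoms induce a nice generating partition of the torus. -/
theorem isNiceGeneratingPartition :
    IsNiceGeneratingPartition (q d (trans v)) fun a => q d '' R a where
  finite := inferInstance
  generating := hR.isGenerating
  regular := hR.isRegular
  liftable := hR.isLiftable
  boundedRemainder := hR.isBoundedRemainder

lemma measurable_pieceCoding : Measurable (pieceCoding v R) :=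
  measurable_coding (measurePreserving_add_right _).measurable
    fun a => (hR.isClosed_atom a).measurableSet

/-- The factors of the codings of regular points are factors of any coding of the orbit of `0`. -/
lemma exists_factor_eq {w : ℕ → Fin (d + 1)} (hw : ∀ m, m • q d (trans v) ∈ q d '' R (w m))
    {z : Torus d} (hz : z ∈ regularSet v R) (k n : ℕ) :
    ∃ m, factor (pieceCoding v R z) k n = factor w m n := by
  -- The points avoiding, throughout the window, every atom other than the one coding `z`. It is
  -- open because atoms are closed, so the dense orbit of `0` enters it, and there `w` has no other
  -- choice of letters, even if that orbit is not regular.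
  set V : Set (Torus d) := ⋂ i : Fin n, ⋂ b : {b // b ≠ pieceCoding v R z (k + i)},
    (fun z => z + (k + i) • q d (trans v)) ⁻¹' (q d '' R b)ᶜ with hV
  have hVo : IsOpen V := isOpen_iInter_of_finite fun i => isOpen_iInter_of_finite fun b =>
    (hR.isClosed_atom b).isOpen_compl.preimage (by fun_prop)
  have hzV : z ∈ V := by
    refine mem_iInter.mpr fun i => mem_iInter.mpr fun b hb => b.2 ?_
    exact ((hR.mem_atom_iff hz _ _).mp hb).symm
  obtain ⟨_, hmV, m, rfl⟩ := (dense_orbit hR.irrational 0).inter_open_nonempty V hVo ⟨z, hzV⟩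
  refine ⟨m + k, List.ext_getElem (by simp) fun i h1 h2 => ?_⟩
  rw [getElem_factor, getElem_factor]
  rw [length_factor] at h1
  by_contra hne
  have h3 := mem_iInter.mp (mem_iInter.mp hmV ⟨i, h1⟩) ⟨w (m + k + i), Ne.symm hne⟩
  refine h3 ?_
  have h4 := hw (m + k + i)
  simp only [zero_add]
  rwa [← add_smul, ← add_assoc]

/-- The coding is a measurable conjugacy with a measure carried by the codings of the regular
points. -/
theorem exists_isMeasurableConjugacy {Ω : Set (ℕ → Fin (d + 1))}
    (hΩ : ∀ z ∈ regularSet v R, pieceCoding v R z ∈ Ω) :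
    ∃ ν : Measure (ℕ → Fin (d + 1)), IsFiniteMeasure ν ∧ ν Ωᶜ = 0 ∧
      MeasurePreserving shift ν ν ∧
      IsMeasurableConjugacy (torusMeasure d) (fun z => z + q d (trans v)) ν shift
        (pieceCoding v R) := by
  have hφ := hR.measurable_pieceCoding
  have hX := hR.measurableSet_regularSet
  have hX0 : torusMeasure d (regularSet v R)ᶜ = 0 := ae_iff.mp hR.ae_mem_regularSet
  have hT := measurePreserving_add_right (q d (trans v))
  have hshift : ∀ z, pieceCoding v R (z + q d (trans v)) = shift (pieceCoding v R z) := fun z => by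
    funext n
    exact shift_coding (fun z => z + q d (trans v)) _ z n
  -- Lusin–Souslin: a measurable injection between standard Borel spaces sends measurable sets to
  -- measurable sets.
  have himage : ∀ C ⊆ regularSet v R, MeasurableSet C → MeasurableSet (pieceCoding v R '' C) :=
    fun C hC hCm => hCm.image_of_measurable_injOn hφ (hR.injOn_pieceCoding.mono hC)
  set ν := (torusMeasure d).map (pieceCoding v R) with hν
  have hY := himage _ Subset.rfl hX
  have hY0 : ν (pieceCoding v R '' regularSet v R)ᶜ = 0 := by
    rw [hν, Measure.map_apply hφ hY.compl]
    exact measure_mono_null (fun z hz hzX => hz (mem_image_of_mem _ hzX)) hX0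
  have hshiftm : Measurable (shift : (ℕ → Fin (d + 1)) → _) :=
    measurable_pi_lambda _ fun n => measurable_pi_apply (n + 1)
  refine ⟨ν, Measure.isFiniteMeasure_map _ _, ?_, ⟨hshiftm, ?_⟩, regularSet v R,
    pieceCoding v R '' regularSet v R, hX, hY, hX0, hY0, fun z hz => add_mem_regularSet hz, ?_,
    hR.injOn_pieceCoding.bijOn_image, fun z _ => hshift z, fun B hB hBm => ⟨hX.inter (hφ hBm), ?_⟩,
    himage⟩
  · refine measure_mono_null (compl_subset_compl.mpr ?_) hY0
    rintro _ ⟨z, hz, rfl⟩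
    exact hΩ z hz
  · rw [hν, Measure.map_map hshiftm hφ]
    conv_rhs => rw [← hT.map_eq, Measure.map_map hφ hT.measurable]
    exact congrArg (fun f => (torusMeasure d).map f) (funext fun z => (hshift z).symm)
  · rintro _ ⟨z, hz, rfl⟩
    exact ⟨_, add_mem_regularSet hz, hshift z⟩
  · rw [hν, Measure.map_apply hφ hBm, inter_comm]
    exact measure_inter_conull hX0

end IsPieceExchange

end

end SAdic

namespace SAdic

open scoped Pointwise

noncomputable section

variable {d : ℕ} {s : ℕ → Substitution d} {v : Simplex d} {r : ℝ}
  {u : ℕ → ℕ → Fin (d + 1)} {K ρ : ℝ}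

/-! ### The language of a directive sequence -/

/-- A zero projection would make `z` a nonzero multiple of `v`, whence the rational relation `z_1
v_0 = z_0 v_1`; two coordinates are needed. -/
lemma proj_toE_ne_zero (hd : 1 ≤ d) (hv : TotallyIrrational v) {z : Fin (d + 1) → ℤ}
    (hz : ∑ i, z i ≠ 0) : proj v (toE z) ≠ 0 := by
  intro h0
  rw [proj_eq_zero_iff, h_toE] at h0
  have hz0 : ((∑ i, z i : ℤ) : ℝ) ≠ 0 := by exact_mod_cast hz
  have hi : ∀ i, (z i : ℝ) = ((∑ i, z i : ℤ) : ℝ) * (v : E d) i := fun i => by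
    have := congrArg (fun y : E d => y i) h0
    simpa using this
  let i₁ : Fin (d + 1) := ⟨1, by omega⟩
  have hne : (0 : Fin (d + 1)) ≠ i₁ := by simp [i₁, Fin.ext_iff]
  have h1 := Fintype.linearIndependent_iff.mp hv
    (Pi.single 0 (z i₁ : ℚ) - Pi.single i₁ (z 0 : ℚ)) (by
      simp only [Pi.sub_apply, sub_smul, Finset.sum_sub_distrib, Pi.single_apply, ite_smul,
        zero_smul, Finset.sum_ite_eq', Finset.mem_univ, if_true, Rat.smul_def, Rat.cast_intCast]
      rw [hi i₁, hi 0]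
      ring) 0
  have h2 : (z i₁ : ℝ) = 0 := by
    simp only [Pi.sub_apply, Pi.single_eq_same, Pi.single_eq_of_ne hne, sub_zero] at h1
    exact_mod_cast h1
  rw [hi i₁] at h2
  exact hv.ne_zero i₁ ((mul_eq_zero.mp h2).resolve_left hz0)

lemma IsFixedPoint.factor_length_img (hu : IsFixedPoint s u) (n : ℕ) :
    factor (u 0) 0 ((comp s n).img (u n 0)).length = (comp s n).img (u n 0) := by
  have h1 := (comp s n).factor_onInfinite (u n) 1
  rw [hu.onInfinite_comp, Substitution.pos, factor_succ, factor_zero, List.nil_append,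
    Substitution.onWord_singleton] at h1
  exact h1

/-- The words `s_{[0,n)}(u_n(0))` are prefixes of `u_0` whose projections tend to `0`. If their
lengths were bounded, these projections would range over finitely many nonzero vectors. -/
lemma exists_le_length_img (hd : 1 ≤ d) (hv : TotallyIrrational v) (hc : IsContracting s v)
    (hu : IsFixedPoint s u) (L : ℕ) : ∃ n, L ≤ ((comp s n).img (u n 0)).length := by
  by_contra! hL
  obtain ⟨C, ρ, hC, hρ, hρ1, hCρ⟩ := hc
  have hlim : Tendsto (fun n : ℕ => C * ρ ^ n) atTop (𝓝 0) := by
    simpa using (tendsto_pow_atTop_nhds_zero_of_lt_one hρ.le hρ1).const_mul C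
  have hev : ∀ᶠ n : ℕ in atTop, ∀ l ∈ Finset.range L, l ≠ 0 →
      C * ρ ^ n < ‖proj v (toE (ab (factor (u 0) 0 l)))‖ := by
    rw [Filter.eventually_all_finset]
    intro l _
    by_cases hl : l = 0
    · exact Eventually.of_forall fun _ h => absurd hl h
    have hne : proj v (toE (ab (factor (u 0) 0 l))) ≠ 0 :=
      proj_toE_ne_zero hd hv (by rw [sum_ab]; simpa using hl)
    exact (hlim.eventually (gt_mem_nhds (norm_pos_iff.mpr hne))).mono fun _ h _ => h
  obtain ⟨n, hn⟩ := hev.exists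
  have h1 := hn _ (Finset.mem_range.mpr (hL n)) ((comp s n).length_img_pos _).ne'
  rw [hu.factor_length_img, ← Substitution.onWord_singleton, Substitution.ab_onWord,
    ← projMat_toE] at h1
  have h2 := hCρ n (toE (ab [u n 0]))
  rw [norm1_toE_ab, List.length_singleton, Nat.cast_one, mul_one] at h2
  exact absurd h1 (not_lt.mpr h2)

lemma factor_mem_language (hd : 1 ≤ d) (hv : TotallyIrrational v) (hc : IsContracting s v)
    (hu : IsFixedPoint s u) (k n : ℕ) : factor (u 0) k n ∈ language s := by
  obtain ⟨N, hN⟩ := exists_le_length_img hd hv hc hu (k + n)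
  obtain ⟨m, hm⟩ := Nat.exists_eq_add_of_le hN
  refine ⟨N, u N 0, factor (u 0) 0 k, factor (u 0) (k + n) m, ?_⟩
  have h1 := hu.factor_length_img N
  rw [hm, factor_add, factor_add, zero_add, zero_add] at h1
  exact h1

/-! ### The exchange of the pieces of the Rauzy fractal -/

/-- The word `u_0` codes the orbit of `0`, although that orbit may meet the boundaries of atoms. -/
lemma nsmul_trans_mem_image_piece (m : ℕ) :
    m • q d (trans v) ∈ q d '' piece s v u 0 (u 0 m) := by
  refine ⟨proj v (toE (ab (factor (u 0) 0 m))), ?_, ?_⟩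
  · rw [← projMat_zero s]
    exact subset_closure ⟨_, ⟨m, rfl, rfl⟩, rfl⟩
  · have h1 := proj_toE_ab_sub_mem_Lam (v := v) (factor (u 0) 0 m)
    rw [length_factor] at h1
    exact q_eq_q_iff.mpr h1

/-- At level `0` the towers have a single floor, so the tiles containing `x` correspond to the lifts
of `q x` in the pieces. -/
lemma preimage_singleSet : q d ⁻¹' singleSet (piece s v u 0) = simpleSet s v u 0 := by
  ext x
  have hhits : ∀ b j (g : Lam d), (b, j, g) ∈ hits s v u 0 x ↔
      j = 0 ∧ x - (g : P d) ∈ piece s v u 0 b := by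
    intro b j g
    simp only [hits, mem_ofPred_eq, comp_zero_img, List.length_singleton, Nat.lt_one_iff]
    refine and_congr_right fun h => ?_
    subst h
    simp
  constructor
  · rintro hx ⟨b, j, g⟩ hτ ⟨b', j', g'⟩ hτ'
    obtain ⟨rfl, h1⟩ := (hhits _ _ _).mp hτ
    obtain ⟨rfl, h2⟩ := (hhits _ _ _).mp hτ'
    have hq : ∀ g : Lam d, q d (x - g) = q d x := fun g => by rw [q_eq_q_iff]; simp
    obtain ⟨rfl, h3⟩ := hx b b' _ _ h1 h2 (hq g) (hq g')
    rw [Subtype.ext (sub_right_injective h3)]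
  · intro hx a a' y y' hy hy' hyx hyx'
    have h1 : x - y ∈ Lam d := q_eq_q_iff.mp hyx.symm
    have h2 : x - y' ∈ Lam d := q_eq_q_iff.mp hyx'.symm
    have h3 := hx (x := (a, 0, ⟨x - y, h1⟩)) (y := (a', 0, ⟨x - y', h2⟩))
      ((hhits _ _ _).mpr ⟨rfl, by simpa using hy⟩) ((hhits _ _ _).mpr ⟨rfl, by simpa using hy'⟩)
    simpa using h3

/-- The translation by the projections of the basis vectors exchanges the pieces of the Rauzy
fractal. -/
theorem isPieceExchange_piece (hd : 1 ≤ d) (hs : ∀ k, (s k).IsUnimodular)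
    (hv : TotallyIrrational v) (hK : PieceBound s v K ρ) (hu : IsFixedPoint s u) (hr : 0 < r)
    (hballs : ∃ᶠ n in atTop, HasBalls s v u r n) : IsPieceExchange v (piece s v u 0) where
  irrational := hv
  isCompact := hK.isCompact_piece hu 0
  closure_interior := piece_zero_eq_closure_interior hs hv hK hu hr hballs
  exchange a x hx := by
    have hcl : IsClosed (⋃ b, piece s v u 0 b) :=
      isClosed_iUnion_of_finite fun b => isClosed_piece u 0 b
    have h1 : piece s v u 0 a ⊆ (fun x => x + proj v (e a)) ⁻¹' ⋃ b, piece s v u 0 b := by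
      refine closure_minimal ?_ (hcl.preimage (by fun_prop))
      rintro _ ⟨_, ⟨m, rfl, rfl⟩, rfl⟩
      -- A prefix followed by `a` extends to the prefix that includes `a`, whose projection lies in
      -- the piece of the next letter.
      refine mem_iUnion.mpr ⟨u 0 (m + 1), subset_closure ⟨_, ⟨m + 1, rfl, rfl⟩, ?_⟩⟩
      simp only [factor_succ, ab_append, ab_singleton, toE_add, toE_single, map_add, projMat_zero]
    exact mem_iUnion.mp (h1 hx)
  cover := by
    have hcl : IsClosed (⋃ a, q d '' piece s v u 0 a) := isClosed_iUnion_of_finite fun a =>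
      ((hK.isCompact_piece hu 0 a).image continuous_q).isClosed
    have h1 : closure (range fun n : ℕ => 0 + n • q d (trans v)) ⊆
        ⋃ a, q d '' piece s v u 0 a := by
      refine closure_minimal ?_ hcl
      rintro _ ⟨m, rfl⟩
      simp only [zero_add]
      exact mem_iUnion.mpr ⟨_, nsmul_trans_mem_image_piece m⟩
    intro z
    exact mem_iUnion.mp (h1 (dense_orbit hv 0 z))
  measurableSet_single := by
    refine measurableSet_quotient.mpr ?_
    have h1 := measurableSet_simpleSet (s := s) (v := v) (u := u) 0
    rw [← preimage_singleSet] at h1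
    exact h1
  ae_single := by
    refine ae_torus_of_ae (measurableSet_quotient.mpr ?_) ?_
    · have h1 := measurableSet_simpleSet (s := s) (v := v) (u := u) 0
      rw [← preimage_singleSet] at h1
      exact h1
    · filter_upwards [ae_mem_simpleSet_zero hd hs hv hK hu hr hballs] with x hx
      rw [← preimage_singleSet] at hx
      exact hx

end

end SAdic

/-! ### The main theorem -/

open SAdic in
theorem theorem3 (d : ℕ) (hd : 1 ≤ d)
    (S : Set (Substitution d)) (hS : S.Finite) (hSu : ∀ σ ∈ S, σ.IsUnimodular)
    (s : ℕ → Substitution d) (hs : ∀ k, s k ∈ S)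
    (v : Simplex d) (hv : IsGoodWithDirection s v)
    (u : ℕ → ℕ → Fin (d + 1)) (hu : IsFixedPoint s u) :
    -- the direction of `s` and the Rauzy fractal of `s` are well defined
    (∀ v' : Simplex d, IsGoodWithDirection s v' → v' = v) ∧
    HasFrequency (u 0) (v : E d) ∧
    (∀ u' : ℕ → ℕ → Fin (d + 1), IsFixedPoint s u' →
      rauzy v (u' 0) = rauzy v (u 0) ∧ ∀ a, rauzyPiece v (u' 0) a = rauzyPiece v (u 0) a) ∧
    -- the Rauzy fractal is a measurable fundamental domain
    MeasurableSet (rauzy v (u 0)) ∧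
    IsAddFundamentalDomain (Lam d) (rauzy v (u 0)) (volume : Measure (P d)) ∧
    -- it is the union of its pieces, disjoint in measure, which are closures of their interiors
    rauzy v (u 0) = ⋃ a, rauzyPiece v (u 0) a ∧
    (∀ a b, a ≠ b →
      (volume : Measure (P d)) (rauzyPiece v (u 0) a ∩ rauzyPiece v (u 0) b) = 0) ∧
    (∀ a, rauzyPiece v (u 0) a = closure (interior (rauzyPiece v (u 0) a))) ∧
    -- the pieces induce a nice generating partition for the translation by `e_0 - v`
    ∃ t : P d, (t : E d) = e 0 - (v : E d) ∧
      IsNiceGeneratingPartition (q d t) (fun a => q d '' rauzyPiece v (u 0) a) ∧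
      -- whose coding is a measurable conjugacy with the subshift of `s`
      ∃ ν : Measure (ℕ → Fin (d + 1)), IsFiniteMeasure ν ∧ ν (subshift s)ᶜ = 0 ∧
        MeasurePreserving shift ν ν ∧
        IsMeasurableConjugacy (torusMeasure d) (fun z => z + q d t) ν shift
          (coding (fun z => z + q d t) (fun a => q d '' rauzyPiece v (u 0) a)) := by
  have hunim : ∀ k, (s k).IsUnimodular := fun k => hSu _ (hs k)
  have hB := exists_length_img_le hS hs
  have hc := hv.isContracting
  have hirr := hv.irrational
  obtain ⟨K, ρ, hK⟩ := hc.exists_pieceBound hB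
  obtain ⟨w, hw, r, hr, hballs⟩ := hv.exists_frequently_hasBalls hunim
  -- The balls are given only along the particular fixed point `w`. All pieces are identified with
  -- those of `w`, for which the piece exchange is established.
  have heq : ∀ u', IsFixedPoint s u' → ∀ a, rauzyPiece v (u' 0) a = piece s v w 0 a :=
    fun u' hu' a => by
      rw [rauzyPiece_eq_piece (s := s)]
      exact Subset.antisymm (piece_zero_subset hunim hirr hK hu' hw hballs a)
        (piece_zero_subset hunim hirr hK hw hu' hballs a)
  have hR := isPieceExchange_piece hd hunim hirr hK hw hr hballs
  have hfun : rauzyPiece v (u 0) = piece s v w 0 := funext (heq u hu)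
  have hunion : ∀ u', IsFixedPoint s u' → rauzy v (u' 0) = ⋃ a, piece s v w 0 a :=
    fun u' hu' => by rw [rauzy_eq_iUnion]; exact iUnion_congr (heq u' hu')
  refine ⟨fun v' hv' => ?_, hc.hasFrequency hB hu, fun u' hu' => ⟨?_, fun a => ?_⟩, ?_, ?_,
    rauzy_eq_iUnion _, ?_, ?_, trans v, coe_trans v, ?_, ?_⟩
  · exact Subtype.ext ((hv'.isContracting.hasFrequency hB hu).unique (hc.hasFrequency hB hu))
  · rw [hunion u' hu', hunion u hu]
  · rw [heq u' hu', heq u hu]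
  · rw [hunion u hu]
    exact hR.isCompact_iUnion.measurableSet
  · rw [hunion u hu]
    exact hR.isAddFundamentalDomain
  · intro a b hab
    rw [hfun]
    exact hR.volume_inter_eq_zero hab
  · intro a
    rw [hfun]
    exact hR.closure_interior a
  · rw [hfun]
    exact hR.isNiceGeneratingPartition
  · rw [hfun]
    refine hR.exists_isMeasurableConjugacy fun z hz k n => ?_
    obtain ⟨m, hm⟩ := hR.exists_factor_eq nsmul_trans_mem_image_piece hz k n
    rw [hm]
    exact factor_mem_language hd hirr hc hw m n
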